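/- **Setting.** Fix $D\ge 1$, $k\ge 0$. For a finite lattice size $L$ put one qubit on each site of the cubic lattice $\Lambda_L=[1,L]^D$, so there are $n=L^D$ physical qubits. A *stabilizer code* is given by an abelian subgroup $\mathcal S$ of the $n$-qubit Pauli group (tensor products of $I,X,Y,Z$ times arbitrary phases) with $-I\notin\mathcal S$; its codespace $\mathcal C$ is the space of vectors fixed by all of $\mathcal S$, and it has $k$ logical qubits if $\dim\mathcal C=2^k$. A *logical operator* is a unitary that preserves $\mathcal C$. The code has distance at least $d$ if every logical Pauli operator supported on fewer than $d$ qubits acts on $\mathcal C$ as a scalar. A *family of $D$-dimensional topological stabilizer codes with $k$ logical qubits* consists of a stabilizer code on $\Lambda_L$ with $k$ logical qubits for every $L$ in an infinite set of lattice sizes, such that the stabilizer groups are generated by elements whose supports have diameter at most a constant $\xi$ independent of $L$, and such that for every $d$ the codes have distance at least $d$ for all large enough $L$ in the set. A basis of $\mathcal C$ is an isometry $J:(\mathbb C^2)^{\otimes k}\to(\mathbb C^2)^{\otimes n}$ with image $\mathcal C$; we only use bases for which the $k$-qubit Pauli group is exactly $\{J^\dagger PJ : P \text{ a logical Pauli operator}\}$.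 Let $\mathcal P_1$ be the $k$-qubit Pauli group and, for $j\ge 2$, $\mathcal P_j=\{U\in U(2^k): U\mathcal P_1U^\dagger\subseteq\mathcal P_{j-1}\}$. A circuit of depth $h$ with gates of range $r$ is a product of $h$ layers, each layer being a product of unitary gates with pairwise disjoint supports of diameter at most $r$. Let $\mathcal G_{h,L}\subseteq U(2^k)$ be the set of encoded gates $J^\dagger UJ$, where $U$ is a logical operator of the code of lattice size $L$ that is realized by a circuit of depth $h$ with gates of range $r$. **Statement.** Consider any family of $D$-dimensional topological stabilizer codes with $k$ logical qubits, $k$ independent of $L$. Then: 1. $\mathcal P_D$ is a finite set up to overall phase factors. 2. For all fixed $r$ and $h$ there is $L_0$ such that for every lattice size $L\ge L_0$ of the family and every basis $J$ as above, the group $\langle\mathcal G_{h,L}\rangle\subseteq U(2^k)$ generated by $\mathcal G_{h,L}$ satisfies $\langle\mathcal G_{h,L}\rangle\subseteq\mathcal P_D$. 3. Consequently, for such $L$, if $k\ge1$, the gates in $\mathcal G_{h,L}$ are not universal: it is not the case that every element of $U(2^k)$ can be approximated to arbitrary precision, up to a phase, by elements of $\langle\mathcal G_{h,L}\rangle$.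 -/

import Mathlib

namespace TopoCode

/-! ### Operators on finitely many qubits -/

/-- Operators on `(ℂ²)^{⊗ Q}`; the computational basis is indexed by bit strings `Q → Fin 2`. -/
abbrev Op (Q : Type) := Matrix (Q → Fin 2) (Q → Fin 2) ℂ

/-- The unitary group of `(ℂ²)^{⊗ Q}`. -/
abbrev UOp (Q : Type) [Fintype Q] [DecidableEq Q] := Matrix.unitaryGroup (Q → Fin 2) ℂ

/-- The labels of the four single-qubit Pauli operators. -/
inductive PauliLabel
  | I
  | X
  | Y
  | Z

/-- The single-qubit Pauli matrices. -/
def PauliLabel.mat : PauliLabel → Matrix (Fin 2) (Fin 2) ℂ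
  | .I => 1
  | .X => !![0, 1; 1, 0]
  | .Y => !![0, -Complex.I; Complex.I, 0]
  | .Z => !![1, 0; 0, -1]

/-- The tensor product of single-qubit operators, by its matrix entries. -/
def tensor {Q : Type} [Fintype Q] (A : Q → Matrix (Fin 2) (Fin 2) ℂ) : Op Q :=
  Matrix.of fun s t => ∏ a, A a (s a) (t a)

/-- `P` belongs to the Pauli group: `P = γ P₁ ⊗ ⋯ ⊗ Pₙ` with a phase `γ`, `|γ| = 1`. -/
def IsPauli {Q : Type} [Fintype Q] (P : Op Q) : Prop :=
  ∃ γ : ℂ, ‖γ‖ = 1 ∧ ∃ p : Q → PauliLabel, P = γ • tensor fun a => (p a).mat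

/-- `A` is supported on the set `M` of qubits: `A = B ⊗ I` with `B` an operator on the qubits
in `M` and `I` the identity on the others. -/
def SupportedOn {Q : Type} (A : Op Q) (M : Finset Q) : Prop :=
  ∃ B : Op M, ∀ s t : Q → Fin 2,
    ((∀ a, a ∉ M → s a = t a) → A s t = B (fun a => s a) (fun a => t a)) ∧
    ((¬ ∀ a, a ∉ M → s a = t a) → A s t = 0)

/-! ### Stabilizer codes -/

/-- A stabilizer code: an abelian subgroup of the Pauli group that does not contain `-I`. -/
structure StabilizerCode (Q : Type) [Fintype Q] [DecidableEq Q] where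
  stab : Subgroup (UOp Q)
  isPauli : ∀ S ∈ stab, IsPauli (S : Op Q)
  comm : ∀ S ∈ stab, ∀ T ∈ stab, S * T = T * S
  neg_one_notMem : ∀ S ∈ stab, (S : Op Q) ≠ -1

section Codes

variable {Q : Type} [Fintype Q] [DecidableEq Q]

/-- The codespace: all vectors fixed by every stabilizer. -/
def StabilizerCode.codespace (C : StabilizerCode Q) : Submodule ℂ ((Q → Fin 2) → ℂ) where
  carrier := {ψ | ∀ S ∈ C.stab, (S : Op Q).mulVec ψ = ψ}
  add_mem' := by
    intro ψ φ hψ hφ S hS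
    rw [Matrix.mulVec_add, hψ S hS, hφ S hS]
  zero_mem' := by
    intro S _
    rw [Matrix.mulVec_zero]
  smul_mem' := by
    intro c ψ hψ S hS
    rw [Matrix.mulVec_smul, hψ S hS]

/-- The code has `k` logical qubits: the codespace has dimension `2 ^ k`. -/
def StabilizerCode.HasLogicalQubits (C : StabilizerCode Q) (k : ℕ) : Prop :=
  Module.finrank ℂ C.codespace = 2 ^ k

/-- Logical operators: unitaries that map the codespace to itself. -/
def StabilizerCode.IsLogical (C : StabilizerCode Q) (U : UOp Q) : Prop :=
  C.codespace.map (U : Op Q).mulVecLin = C.codespace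

/-- The code has distance (at least) `d`: every logical Pauli operator supported on fewer than
`d` qubits acts on the codespace as a scalar. -/
def StabilizerCode.HasDistance (C : StabilizerCode Q) (d : ℕ) : Prop :=
  ∀ P : UOp Q, IsPauli (P : Op Q) → C.IsLogical P →
    (∃ M : Finset Q, M.card < d ∧ SupportedOn (P : Op Q) M) →
    ∃ c : ℂ, ∀ ψ ∈ C.codespace, (P : Op Q).mulVec ψ = c • ψ

/-- The encoded operator `J† O J`. -/
def encoded {k : ℕ} (J : Matrix (Q → Fin 2) (Fin k → Fin 2) ℂ) (O : Op Q) : Op (Fin k) :=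
  J.conjTranspose * O * J

/-- `J` is an admissible choice of basis of the codespace: an isometry from `k` qubits onto the
codespace, such that the `k`-qubit Pauli group is exactly the set of encoded operators of the
logical Pauli operators. -/
structure StabilizerCode.IsEncoding (C : StabilizerCode Q) {k : ℕ}
    (J : Matrix (Q → Fin 2) (Fin k → Fin 2) ℂ) : Prop where
  isometry : J.conjTranspose * J = 1
  range_eq : LinearMap.range J.mulVecLin = C.codespace
  pauli : {A : Op (Fin k) | IsPauli A} =
    {A : Op (Fin k) | ∃ P : UOp Q, IsPauli (P : Op Q) ∧ C.IsLogical P ∧ encoded J P = A}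

end Codes

/-! ### The sets `𝒫_j` of encoded gates -/

/-- `hierarchy k j` is `𝒫_j` on `k` qubits for `j ≥ 1`: `𝒫_1` is the Pauli group, and `𝒫_{j+1}`
is the set of unitaries `U` with `U 𝒫_1 U† ⊆ 𝒫_j`. The value at `j = 0` is a dummy. -/
def hierarchy (k : ℕ) : ℕ → Set (UOp (Fin k))
  | 0 => ∅
  | 1 => {U | IsPauli (U : Op (Fin k))}
  | j + 2 => {U | ∀ P : UOp (Fin k), IsPauli (P : Op (Fin k)) → U * P * star U ∈ hierarchy k (j + 1)}

/-- A set of unitaries is finite up to overall phase factors. -/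
def FiniteUpToPhase {k : ℕ} (A : Set (UOp (Fin k))) : Prop :=
  ∃ F : Set (UOp (Fin k)), F.Finite ∧
    ∀ U ∈ A, ∃ V ∈ F, ∃ γ : ℂ, ‖γ‖ = 1 ∧ (U : Op (Fin k)) = γ • (V : Op (Fin k))

/-- A set of gates on `k` qubits is universal: every unitary can be approximated to any precision,
up to an overall phase, by elements of the group generated by the gates. -/
def IsUniversal {k : ℕ} (A : Set (UOp (Fin k))) : Prop :=
  ∀ V : UOp (Fin k), ∀ ε : ℝ, 0 < ε → ∃ W ∈ Subgroup.closure A, ∃ γ : ℂ, ‖γ‖ = 1 ∧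
    ∀ s t : Fin k → Fin 2, ‖(V : Op (Fin k)) s t - γ * (W : Op (Fin k)) s t‖ < ε

/-! ### Geometry, local circuits, topological stabilizer codes -/

/-- The cubic lattice `[1, L]^D` (coordinates shifted to start at `0`); one qubit per site. -/
abbrev Site (D L : ℕ) := Fin D → Fin L

/-- The set `M` has diameter at most `ρ` (in the maximum metric of `ℤ^D`). -/
def DiamLE {D L : ℕ} (M : Finset (Site D L)) (ρ : ℕ) : Prop :=
  ∀ a ∈ M, ∀ b ∈ M, ∀ i, |((a i : ℕ) : ℤ) - ((b i : ℕ) : ℤ)| ≤ (ρ : ℤ)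

/-- A gate of range at most `r`: a unitary supported on a set of diameter at most `r`. -/
structure Gate (D L r : ℕ) where
  supp : Finset (Site D L)
  op : UOp (Site D L)
  supported : SupportedOn (op : Op (Site D L)) supp
  diam : DiamLE supp r

/-- A layer: gates with pairwise disjoint supports (which therefore commute). -/
structure Layer (D L r : ℕ) where
  gates : List (Gate D L r)
  disjoint : gates.Pairwise fun g g' => Disjoint g.supp g'.supp

/-- The unitary performed by a layer. -/
def Layer.op {D L r : ℕ} (l : Layer D L r) : UOp (Site D L) :=
  (l.gates.map Gate.op).prod

/-- `U` is performed by a circuit of depth `h` (a sequence of `h` layers, possibly with idle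
qubits) with gates of range at most `r`. -/
def ImplementableBy (D L r h : ℕ) (U : UOp (Site D L)) : Prop :=
  ∃ c : List (Layer D L r), c.length = h ∧ U = (c.map Layer.op).prod

/-- The set `𝒢_{h,L}` of encoded gates, with respect to the basis `J`, that are implemented by
logical operators realized by circuits of depth `h` with gates of range at most `r`. -/
def protectedGates {D L k : ℕ} (C : StabilizerCode (Site D L))
    (J : Matrix (Site D L → Fin 2) (Fin k → Fin 2) ℂ) (r h : ℕ) : Set (UOp (Fin k)) :=
  {g | ∃ U : UOp (Site D L), ImplementableBy D L r h U ∧ C.IsLogical U ∧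
    (g : Op (Fin k)) = encoded J U}

/-- The codes `C L`, for `L` in the infinite set `Ls` of lattice sizes, form a family of
`D`-dimensional topological stabilizer codes with `k` logical qubits: the stabilizer groups are
generated by elements whose supports have diameters bounded by one constant `ξ`, and the distance
tends to infinity with `L`. -/
structure IsTopologicalFamily (D k : ℕ) (Ls : Set ℕ)
    (C : (L : ℕ) → StabilizerCode (Site D L)) : Prop where
  infinite : Ls.Infinite
  logicalQubits : ∀ L ∈ Ls, (C L).HasLogicalQubits k
  localGenerators : ∃ ξ : ℕ, ∀ L ∈ Ls, Subgroup.closure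
    {S : UOp (Site D L) | S ∈ (C L).stab ∧
      ∃ M : Finset (Site D L), DiamLE M ξ ∧ SupportedOn (S : Op (Site D L)) M} = (C L).stab
  distance : ∀ d : ℕ, ∃ L₀ : ℕ, ∀ L ∈ Ls, L₀ ≤ L → (C L).HasDistance d

end TopoCode

namespace TopoCode

/-! ### Pauli operators labelled by binary vectors -/

/-! The core is a commutator argument. The lattice has `D + 1` correctable sets `Λ 0, …, Λ D`, where
correctable means that every logical Pauli on the set is trivial. They are chosen so that a site
close to the complement of each of `Λ 0, …, Λ (D - 1)` lies in `Λ D`. By the cleaning lemma every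
encoded Pauli has a lift supported off a given `Λ j`. Given a shallow logical circuit `U`, form
nested group commutators with Paulis cleaned off `Λ 0`, then `Λ 1`, and so on. Since `U` spreads
supports by a bounded amount, the `j`-th step confines the commutator near the complement of `Λ j`.
After `D` steps it lives on `Λ D`, so it acts on the code as a scalar. Unwinding the commutators
puts the encoded gate in `hierarchy k D` (`exists_commutator`, `encoded_mem_hierarchy`).

The sets come from grids of boxes of constant size separated by walls, the grids being shifts of one
another. Each box is smaller than the distance, and no local generator touches two boxes, so the
union of the boxes is correctable (`correctable_of_pieces`). The covering property is a pigeonhole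
on `D + 1` shifts and `D` coordinates (`mem_awayFromWalls_of_thicken`).

Each level of the hierarchy is finite up to phase, because a unitary is determined up to a Pauli and
a phase by its conjugation action on Paulis (`finiteUpToPhase_hierarchy`).

The hierarchy is not shown to be a group, so passing to the generated group needs another argument.
The encoded gates of depth `h * m` grow with `m`, and while they stay in a finite set up to phases,
two consecutive depths must give the same gates up to phases. From then on, multiplying by
generators leads to nothing new (`closure_protectedGates_phase`). A group finite up to phases cannot
be dense (`not_isUniversal_of_finiteUpToPhase`). -/

/-- The Pauli label of a binary vector `(x, z)`: the operator is `X^x Z^z` up to a phase. -/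
def labelOf (v : ZMod 2 × ZMod 2) : PauliLabel :=
  if v.1 = 0 then (if v.2 = 0 then .I else .Z) else (if v.2 = 0 then .X else .Y)

/-- The single-qubit Pauli matrix labelled by a binary vector. -/
def siteMat (v : ZMod 2 × ZMod 2) : Matrix (Fin 2) (Fin 2) ℂ := (labelOf v).mat

/-- The symplectic form on single-qubit Pauli labels. -/
def siteForm (v w : ZMod 2 × ZMod 2) : ZMod 2 := v.1 * w.2 + v.2 * w.1

/-- The sign `(-1)^c`. -/
def sgn (c : ZMod 2) : ℂ := if c = 0 then 1 else -1

theorem zmod_two_cases (a : ZMod 2) : a = 0 ∨ a = 1 := by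
  revert a; decide

theorem sgn_add (a b : ZMod 2) : sgn (a + b) = sgn a * sgn b := by
  have h : (1 : ZMod 2) + 1 = 0 := by decide
  rcases zmod_two_cases a with rfl | rfl <;> rcases zmod_two_cases b with rfl | rfl <;>
    simp [sgn, h]

@[simp] theorem sgn_zero : sgn 0 = 1 := by simp [sgn]

theorem sgn_sum {ι : Type} (s : Finset ι) (f : ι → ZMod 2) :
    sgn (∑ i ∈ s, f i) = ∏ i ∈ s, sgn (f i) := by
  classical
  induction s using Finset.induction_on with
  | empty => simp
  | insert a s ha ih => rw [Finset.sum_insert ha, Finset.prod_insert ha, sgn_add, ih]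

theorem sgn_eq_one_iff (a : ZMod 2) : sgn a = 1 ↔ a = 0 := by
  rcases zmod_two_cases a with rfl | rfl
  · simp
  · simp only [sgn, one_ne_zero, if_false, iff_false]
    norm_num

theorem siteMat_zero : siteMat 0 = 1 := by simp [siteMat, labelOf, PauliLabel.mat]

theorem siteMat_label (p : PauliLabel) : ∃ v, siteMat v = p.mat := by
  cases p
  · exact ⟨(0, 0), by simp [siteMat, labelOf]⟩
  · exact ⟨(1, 0), by simp [siteMat, labelOf]⟩
  · exact ⟨(1, 1), by simp [siteMat, labelOf]⟩
  · exact ⟨(0, 1), by simp [siteMat, labelOf]⟩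

theorem siteMat_mul (v w : ZMod 2 × ZMod 2) :
    ∃ γ : ℂ, ‖γ‖ = 1 ∧ siteMat v * siteMat w = γ • siteMat (v + w) := by
  obtain ⟨x, z⟩ := v
  obtain ⟨x', z'⟩ := w
  have h : (1 : ZMod 2) + 1 = 0 := by decide
  have key : ∃ γ ∈ ({1, -1, Complex.I, -Complex.I} : Set ℂ),
      siteMat (x, z) * siteMat (x', z') = γ • siteMat ((x, z) + (x', z')) := by
    rcases zmod_two_cases x with rfl | rfl <;> rcases zmod_two_cases z with rfl | rfl <;>
    rcases zmod_two_cases x' with rfl | rfl <;> rcases zmod_two_cases z' with rfl | rfl <;>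
    simp [siteMat, labelOf, PauliLabel.mat, h, Matrix.one_fin_two]
  obtain ⟨γ, hγ, e⟩ := key
  refine ⟨γ, ?_, e⟩
  rcases hγ with rfl | rfl | rfl | rfl <;> simp

theorem siteMat_comm (v w : ZMod 2 × ZMod 2) :
    siteMat v * siteMat w = sgn (siteForm v w) • (siteMat w * siteMat v) := by
  obtain ⟨x, z⟩ := v
  obtain ⟨x', z'⟩ := w
  have h : (1 : ZMod 2) + 1 = 0 := by decide
  rcases zmod_two_cases x with rfl | rfl <;> rcases zmod_two_cases z with rfl | rfl <;>
  rcases zmod_two_cases x' with rfl | rfl <;> rcases zmod_two_cases z' with rfl | rfl <;>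
  simp [siteMat, labelOf, PauliLabel.mat, h, siteForm, sgn]

theorem siteMat_sq (v : ZMod 2 × ZMod 2) : siteMat v * siteMat v = 1 := by
  obtain ⟨x, z⟩ := v
  rcases zmod_two_cases x with rfl | rfl <;> rcases zmod_two_cases z with rfl | rfl <;>
  simp [siteMat, labelOf, PauliLabel.mat, Matrix.one_fin_two]

theorem siteMat_conjTranspose (v : ZMod 2 × ZMod 2) : (siteMat v).conjTranspose = siteMat v := by
  obtain ⟨x, z⟩ := v
  rcases zmod_two_cases x with rfl | rfl <;> rcases zmod_two_cases z with rfl | rfl <;>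
  ext i j <;> fin_cases i <;> fin_cases j <;>
  simp [siteMat, labelOf, PauliLabel.mat, Matrix.conjTranspose_apply]

/-! ### Tensor products and the multi-qubit Pauli operators. -/

section Tensor

variable {Q : Type} [Fintype Q]

theorem tensor_mul [DecidableEq Q] (A B : Q → Matrix (Fin 2) (Fin 2) ℂ) :
    tensor A * tensor B = tensor fun a => A a * B a := by
  ext s t
  simp only [tensor, Matrix.mul_apply, Matrix.of_apply]
  rw [Finset.prod_univ_sum]
  simp [Finset.prod_mul_distrib]

theorem tensor_smul (c : Q → ℂ) (A : Q → Matrix (Fin 2) (Fin 2) ℂ) :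
    (tensor fun a => c a • A a) = (∏ a, c a) • tensor A := by
  ext s t
  simp [tensor, Finset.prod_mul_distrib]

theorem tensor_one : tensor (fun _ : Q => (1 : Matrix (Fin 2) (Fin 2) ℂ)) = 1 := by
  classical
  ext s t
  simp only [tensor, Matrix.of_apply, Matrix.one_apply, Finset.prod_ite_zero, Finset.prod_const_one,
    Finset.mem_univ, true_imp_iff, funext_iff]

theorem tensor_conjTranspose (A : Q → Matrix (Fin 2) (Fin 2) ℂ) :
    (tensor A).conjTranspose = tensor fun a => (A a).conjTranspose := by
  ext s t
  simp [tensor, Matrix.conjTranspose_apply]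

/-- The Pauli operator labelled by a binary vector. -/
def pauliOp (v : Q → ZMod 2 × ZMod 2) : Op Q := tensor fun a => siteMat (v a)

/-- The symplectic form on Pauli labels. -/
def sympForm (v w : Q → ZMod 2 × ZMod 2) : ZMod 2 := ∑ a, siteForm (v a) (w a)

theorem sympForm_comm (v w : Q → ZMod 2 × ZMod 2) : sympForm v w = sympForm w v := by
  refine Finset.sum_congr rfl fun a _ => ?_
  simp only [siteForm]
  ring

theorem isPauli_iff (P : Op Q) :
    IsPauli P ↔ ∃ γ : ℂ, ‖γ‖ = 1 ∧ ∃ v, P = γ • pauliOp v := by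
  constructor
  · rintro ⟨γ, hγ, p, rfl⟩
    choose v hv using fun a => siteMat_label (p a)
    exact ⟨γ, hγ, v, by simp only [pauliOp, hv]⟩
  · rintro ⟨γ, hγ, v, rfl⟩
    exact ⟨γ, hγ, fun a => labelOf (v a), rfl⟩

theorem isPauli_pauliOp (v : Q → ZMod 2 × ZMod 2) : IsPauli (pauliOp v) :=
  (isPauli_iff _).2 ⟨1, by simp, v, by simp⟩

theorem pauliOp_zero : pauliOp (0 : Q → ZMod 2 × ZMod 2) = 1 := by
  simp only [pauliOp, Pi.zero_apply, siteMat_zero, tensor_one]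

variable [DecidableEq Q]

theorem pauliOp_mul (v w : Q → ZMod 2 × ZMod 2) :
    ∃ γ : ℂ, ‖γ‖ = 1 ∧ pauliOp v * pauliOp w = γ • pauliOp (v + w) := by
  choose γ hγ e using fun a => siteMat_mul (v a) (w a)
  refine ⟨∏ a, γ a, by simp [hγ], ?_⟩
  simp only [pauliOp, tensor_mul, e, tensor_smul, Pi.add_apply]

theorem pauliOp_comm (v w : Q → ZMod 2 × ZMod 2) :
    pauliOp v * pauliOp w = sgn (sympForm v w) • (pauliOp w * pauliOp v) := by
  simp only [pauliOp, tensor_mul]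
  rw [sympForm, sgn_sum, ← tensor_smul]
  congr 1
  funext a
  exact siteMat_comm _ _

theorem pauliOp_sq (v : Q → ZMod 2 × ZMod 2) : pauliOp v * pauliOp v = 1 := by
  simp only [pauliOp, tensor_mul, siteMat_sq, tensor_one]

omit [DecidableEq Q] in
theorem pauliOp_conjTranspose (v : Q → ZMod 2 × ZMod 2) :
    (pauliOp v).conjTranspose = pauliOp v := by
  simp only [pauliOp, tensor_conjTranspose, siteMat_conjTranspose]

/-- The Pauli operator labelled by a binary vector, as a unitary. -/
def pauliU (v : Q → ZMod 2 × ZMod 2) : UOp Q :=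
  ⟨pauliOp v, by
    rw [Matrix.mem_unitaryGroup_iff, Matrix.star_eq_conjTranspose, pauliOp_conjTranspose,
      pauliOp_sq]⟩

@[simp] theorem coe_pauliU (v : Q → ZMod 2 × ZMod 2) : (pauliU v : Op Q) = pauliOp v := rfl

omit [DecidableEq Q] in
theorem IsPauli.smul {P : Op Q} (hP : IsPauli P) {γ : ℂ} (hγ : ‖γ‖ = 1) : IsPauli (γ • P) := by
  obtain ⟨δ, hδ, p, rfl⟩ := hP
  exact ⟨γ * δ, by simp [hγ, hδ], p, by rw [smul_smul]⟩

theorem IsPauli.mul {P R : Op Q} (hP : IsPauli P) (hR : IsPauli R) : IsPauli (P * R) := by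
  obtain ⟨γ, hγ, v, rfl⟩ := (isPauli_iff _).1 hP
  obtain ⟨δ, hδ, w, rfl⟩ := (isPauli_iff _).1 hR
  obtain ⟨ε, hε, e⟩ := pauliOp_mul v w
  refine (isPauli_iff _).2 ⟨γ * δ * ε, by simp [hγ, hδ, hε], v + w, ?_⟩
  rw [smul_mul_smul_comm, e, smul_smul]

omit [DecidableEq Q] in
theorem IsPauli.star {P : Op Q} (hP : IsPauli P) : IsPauli (star P) := by
  obtain ⟨γ, hγ, v, rfl⟩ := (isPauli_iff _).1 hP
  refine (isPauli_iff _).2 ⟨Star.star γ, by simpa using hγ, v, ?_⟩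
  rw [star_smul, Matrix.star_eq_conjTranspose, pauliOp_conjTranspose]

theorem pauli_comm_phase {P R : Op Q} (hP : IsPauli P) (hR : IsPauli R) :
    ∃ γ : ℂ, P * R = γ • (R * P) := by
  obtain ⟨γ, hγ, v, rfl⟩ := (isPauli_iff _).1 hP
  obtain ⟨δ, hδ, w, rfl⟩ := (isPauli_iff _).1 hR
  refine ⟨sgn (sympForm v w), ?_⟩
  rw [smul_mul_smul_comm, smul_mul_smul_comm, pauliOp_comm v w, smul_smul, smul_smul]
  congr 1
  ring

/-! ### Supports -/

omit [Fintype Q] [DecidableEq Q] in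
theorem SupportedOn.entry_eq {A : Op Q} {M : Finset Q} (hA : SupportedOn A M)
    {s t s' t' : Q → Fin 2} (h : ∀ a ∉ M, s a = t a) (h' : ∀ a ∉ M, s' a = t' a)
    (hs : ∀ a ∈ M, s a = s' a) (ht : ∀ a ∈ M, t a = t' a) : A s t = A s' t' := by
  obtain ⟨B, hB⟩ := hA
  rw [(hB s t).1 h, (hB s' t').1 h']
  congr 1
  · funext a; exact hs a a.2
  · funext a; exact ht a a.2

omit [Fintype Q] [DecidableEq Q] in
theorem SupportedOn.entry_zero {A : Op Q} {M : Finset Q} (hA : SupportedOn A M)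
    {s t : Q → Fin 2} (h : ¬ ∀ a, a ∉ M → s a = t a) : A s t = 0 := by
  obtain ⟨B, hB⟩ := hA
  exact (hB s t).2 h

/-- Only one intermediate bit string can contribute: the factor `A` leaves bits off `M` unchanged,
and `B` leaves those in `M` unchanged because `M` and `N` are disjoint. -/
theorem SupportedOn.mul_apply {A B : Op Q} {M N : Finset Q} (hA : SupportedOn A M)
    (hB : SupportedOn B N) (hMN : Disjoint M N) (s t : Q → Fin 2) :
    (A * B) s t = A s (fun a => if a ∈ M then t a else s a) *
      B (fun a => if a ∈ M then t a else s a) t := by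
  rw [Matrix.mul_apply]
  refine Finset.sum_eq_single _ ?_ (by simp)
  intro u _ hu
  by_contra h
  obtain ⟨h1, h2⟩ := mul_ne_zero_iff.1 h
  have h1' : ∀ a, a ∉ M → s a = u a := by
    by_contra h'; exact h1 (hA.entry_zero h')
  have h2' : ∀ a, a ∉ N → u a = t a := by
    by_contra h'; exact h2 (hB.entry_zero h')
  refine hu (funext fun a => ?_)
  by_cases ha : a ∈ M
  · simp only [ha, if_true]
    exact h2' a (Finset.disjoint_left.1 hMN ha)
  · simp only [ha, if_false]
    exact (h1' a ha).symm

theorem SupportedOn.mul_comm_of_disjoint {A B : Op Q} {M N : Finset Q} (hA : SupportedOn A M)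
    (hB : SupportedOn B N) (hMN : Disjoint M N) : A * B = B * A := by
  ext s t
  rw [hA.mul_apply hB hMN, hB.mul_apply hA hMN.symm, mul_comm]
  by_cases h : ∀ a, a ∉ M → a ∉ N → s a = t a
  · have hd : ∀ a, a ∈ M → a ∉ N := fun a ha => Finset.disjoint_left.1 hMN ha
    congr 1
    · refine hB.entry_eq ?_ ?_ ?_ ?_ <;> intro a ha
      · by_cases hM : a ∈ M
        · simp [hM]
        · simp [hM, h a hM ha]
      · simp [ha]
      · have : a ∉ M := fun h' => hd a h' ha
        simp [this]
      · simp [ha]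
    · refine hA.entry_eq ?_ ?_ ?_ ?_ <;> intro a ha
      · simp [ha]
      · by_cases hN : a ∈ N
        · simp [hN]
        · simp [hN, h a ha hN]
      · simp [hd a ha]
      · simp [ha]
  · push Not at h
    obtain ⟨a, haM, haN, hne⟩ := h
    rw [hB.entry_zero (s := fun a => if a ∈ M then t a else s a),
      hA.entry_zero (s := fun a => if a ∈ N then t a else s a)]
    · simp
    · intro h'
      have := h' a haM
      simp only [haN, if_false] at this
      exact hne this
    · intro h'
      have := h' a haN
      simp only [haM, if_false] at this
      exact hne this

end Tensor

/-! ### Supports detected by commutation with single-qubit Paulis. -/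

section

variable {Q : Type} [Fintype Q] [DecidableEq Q]

theorem pauliOp_single_apply (a : Q) (e : ZMod 2 × ZMod 2) (s t : Q → Fin 2) :
    pauliOp (Pi.single a e) s t = siteMat e (s a) (t a) * if ∀ b, b ≠ a → s b = t b then 1 else 0 := by
  simp only [pauliOp, tensor, Matrix.of_apply]
  rw [← Finset.mul_prod_erase _ _ (Finset.mem_univ a), Pi.single_eq_same]
  congr 1
  rw [Finset.prod_congr rfl (g := fun b => if s b = t b then 1 else 0)]
  · rw [Finset.prod_ite_zero]
    simp
  · intro b hb
    rw [Pi.single_eq_of_ne (Finset.ne_of_mem_erase hb), siteMat_zero, Matrix.one_apply]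

theorem supportedOn_pauliOp {v : Q → ZMod 2 × ZMod 2} {M : Finset Q} (hv : ∀ a ∉ M, v a = 0) :
    SupportedOn (pauliOp v) M := by
  have key : ∀ s t : Q → Fin 2, pauliOp v s t =
      (∏ a : M, siteMat (v a) (s a) (t a)) * if ∀ a, a ∉ M → s a = t a then 1 else 0 := by
    intro s t
    simp only [pauliOp, tensor, Matrix.of_apply]
    rw [← Finset.prod_mul_prod_compl M, ← Finset.prod_coe_sort M]
    congr 1
    rw [Finset.prod_congr rfl (g := fun b => if s b = t b then 1 else 0)]
    · rw [Finset.prod_ite_zero]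
      simp
    · intro b hb
      rw [hv b (Finset.mem_compl.1 hb), siteMat_zero, Matrix.one_apply]
  refine ⟨tensor fun a : M => siteMat (v a), fun s t => ⟨fun h => ?_, fun h => ?_⟩⟩
  · rw [key, if_pos h, mul_one]
    rfl
  · rw [key, if_neg h, mul_zero]

/-- The bit string `s` with the bit at `a` flipped. -/
def flipBit (a : Q) (s : Q → Fin 2) : Q → Fin 2 := Function.update s a (s a + 1)

omit [Fintype Q] in
theorem flipBit_flipBit (a : Q) (s : Q → Fin 2) : flipBit a (flipBit a s) = s := by
  have h : ∀ x : Fin 2, x + 1 + 1 = x := by decide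
  funext b
  by_cases hb : b = a
  · subst hb; simp [flipBit, h]
  · simp [flipBit, hb]

theorem pauliOp_single_X (a : Q) (s t : Q → Fin 2) :
    pauliOp (Pi.single a (1, 0)) s t = if t = flipBit a s then 1 else 0 := by
  have h : ∀ x y : Fin 2, siteMat (1, 0) x y = if y = x + 1 then 1 else 0 := by
    intro x y
    fin_cases x <;> fin_cases y <;> simp [siteMat, labelOf, PauliLabel.mat]
  rw [pauliOp_single_apply, h, ite_zero_mul_ite_zero, mul_one]
  refine if_congr ?_ rfl rfl
  rw [funext_iff]
  constructor
  · rintro ⟨h1, h2⟩ b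
    by_cases hb : b = a
    · subst hb; simp [flipBit, h1]
    · simp [flipBit, hb, h2 b hb]
  · intro h'
    refine ⟨by simpa [flipBit] using h' a, fun b hb => ?_⟩
    simpa [flipBit, hb] using (h' b).symm

theorem pauliOp_single_Z (a : Q) :
    pauliOp (Pi.single a (0, 1)) =
      Matrix.diagonal fun s : Q → Fin 2 => if s a = 0 then (1 : ℂ) else -1 := by
  ext s t
  rw [pauliOp_single_apply, Matrix.diagonal_apply]
  by_cases hst : s = t
  · subst hst
    have h0 : ∀ x : Fin 2, siteMat (0, 1) x x = if x = 0 then 1 else -1 := by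
      intro x
      fin_cases x <;> simp [siteMat, labelOf, PauliLabel.mat]
    simp [h0]
  · rw [if_neg hst]
    by_cases h : ∀ b, b ≠ a → s b = t b
    · have hne : s a ≠ t a := by
        intro h'
        refine hst (funext fun b => ?_)
        by_cases hb : b = a
        · rw [hb, h']
        · exact h b hb
      have : ∀ x y : Fin 2, x ≠ y → siteMat (0, 1) x y = 0 := by
        intro x y
        fin_cases x <;> fin_cases y <;> simp [siteMat, labelOf, PauliLabel.mat]
      rw [this _ _ hne, zero_mul]
    · rw [if_neg h, mul_zero]

theorem apply_eq_zero_of_commute_Z {A : Op Q} {a : Q}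
    (h : Commute A (pauliOp (Pi.single a (0, 1)))) {s t : Q → Fin 2} (hst : s a ≠ t a) :
    A s t = 0 := by
  have h' := congrFun (congrFun h.eq s) t
  rw [pauliOp_single_Z, Matrix.mul_diagonal, Matrix.diagonal_mul] at h'
  have h0 : ∀ x : Fin 2, x = 0 ∨ x = 1 := by decide
  rcases h0 (s a) with hs | hs <;> rcases h0 (t a) with ht | ht <;>
    simp [hs, ht] at hst h'
  · linear_combination (-1 / 2) * h'
  · linear_combination (1 / 2) * h'

theorem apply_flipBit_of_commute_X {A : Op Q} {a : Q}
    (h : Commute A (pauliOp (Pi.single a (1, 0)))) (s t : Q → Fin 2) :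
    A (flipBit a s) (flipBit a t) = A s t := by
  have h' := congrFun (congrFun h.eq s) (flipBit a t)
  simp only [Matrix.mul_apply, pauliOp_single_X] at h'
  rw [Finset.sum_eq_single t, Finset.sum_eq_single (flipBit a s)] at h'
  · simpa using h'.symm
  · intro u _ hu; simp [hu]
  · simp
  · intro u _ hu
    rw [if_neg, mul_zero]
    intro h''
    exact hu (by rw [← flipBit_flipBit a u, ← h'', flipBit_flipBit])
  · simp

/-- Commuting with `X` at `a` makes entries invariant under flipping that bit in both indices, so a
common bit can be reset to `0`. -/
theorem apply_zeroBit_of_commute {A : Op Q} {a : Q}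
    (h : ∀ e, Commute A (pauliOp (Pi.single a e))) {s t : Q → Fin 2} (hst : s a = t a) :
    A (Function.update s a 0) (Function.update t a 0) = A s t := by
  have h0 : ∀ x : Fin 2, x = 0 ∨ x = 1 := by decide
  rcases h0 (s a) with hs | hs
  · rw [← hs, Function.update_eq_self, hst, Function.update_eq_self]
  · rw [← apply_flipBit_of_commute_X (h (1, 0)) s t]
    simp only [flipBit, ← hst, hs]
    rfl

/-- An operator is supported on `M` iff it commutes with the Pauli operators on all single
qubits outside `M`. -/
theorem supportedOn_iff (A : Op Q) (M : Finset Q) :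
    SupportedOn A M ↔ ∀ a ∉ M, ∀ e, Commute A (pauliOp (Pi.single a e)) := by
  constructor
  · intro hA a ha e
    refine hA.mul_comm_of_disjoint (N := {a}) (supportedOn_pauliOp ?_) (by simpa using ha)
    intro b hb
    exact Pi.single_eq_of_ne (by simpa using hb) _
  · intro h
    -- Bits outside `M` are reset to `0` one site at a time, so an entry whose indices agree off `M`
    -- depends only on the bits in `M`.
    have key : ∀ F : Finset Q, Disjoint M F → ∀ s t : Q → Fin 2, (∀ a ∈ F, s a = t a) →
        A (fun a => if a ∈ F then 0 else s a) (fun a => if a ∈ F then 0 else t a) = A s t := by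
      intro F
      induction F using Finset.induction_on with
      | empty => simp
      | insert b F hb ih =>
        intro hF s t hst
        rw [Finset.disjoint_insert_right] at hF
        rw [← ih hF.2 s t fun a ha => hst a (Finset.mem_insert_of_mem ha),
          ← apply_zeroBit_of_commute (h b hF.1)
            (s := fun a => if a ∈ F then 0 else s a) (t := fun a => if a ∈ F then 0 else t a)]
        · congr 1 <;> funext a <;> by_cases hab : a = b <;> simp [hab]
        · simp [hb, hst b (Finset.mem_insert_self _ _)]
    refine ⟨Matrix.of fun u v => A (fun a => if ha : a ∈ M then u ⟨a, ha⟩ else 0)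
      (fun a => if ha : a ∈ M then v ⟨a, ha⟩ else 0), fun s t => ⟨fun hst => ?_, fun hst => ?_⟩⟩
    · rw [← key Mᶜ disjoint_compl_right s t fun a ha => hst a (Finset.mem_compl.1 ha)]
      simp only [Matrix.of_apply]
      congr 1 <;> funext a <;> by_cases ha : a ∈ M <;> simp [ha]
    · push Not at hst
      obtain ⟨a, ha, hne⟩ := hst
      exact apply_eq_zero_of_commute_Z (h a ha (0, 1)) hne

theorem SupportedOn.mono {A : Op Q} {M N : Finset Q} (hA : SupportedOn A M) (h : M ⊆ N) :
    SupportedOn A N := by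
  rw [supportedOn_iff] at hA ⊢
  exact fun a ha => hA a fun h' => ha (h h')

theorem SupportedOn.inter {A : Op Q} {M N : Finset Q} (hA : SupportedOn A M)
    (hA' : SupportedOn A N) : SupportedOn A (M ∩ N) := by
  rw [supportedOn_iff] at hA hA' ⊢
  intro a ha
  by_cases hM : a ∈ M
  · exact hA' a fun hN => ha (Finset.mem_inter.2 ⟨hM, hN⟩)
  · exact hA a hM

theorem SupportedOn.mul {A B : Op Q} {M : Finset Q} (hA : SupportedOn A M)
    (hB : SupportedOn B M) : SupportedOn (A * B) M := by
  rw [supportedOn_iff] at hA hB ⊢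
  exact fun a ha e => (hA a ha e).mul_left (hB a ha e)

theorem SupportedOn.smul {A : Op Q} {M : Finset Q} (hA : SupportedOn A M) (c : ℂ) :
    SupportedOn (c • A) M := by
  rw [supportedOn_iff] at hA ⊢
  exact fun a ha e => (hA a ha e).smul_left c

theorem SupportedOn.star {A : Op Q} {M : Finset Q} (hA : SupportedOn A M) :
    SupportedOn (star A) M := by
  rw [supportedOn_iff] at hA ⊢
  intro a ha e
  have := (hA a ha e).star_star
  rwa [Matrix.star_eq_conjTranspose (pauliOp _), pauliOp_conjTranspose] at this

theorem supportedOn_univ (A : Op Q) : SupportedOn A Finset.univ := by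
  rw [supportedOn_iff]
  simp

theorem sympForm_single (v : Q → ZMod 2 × ZMod 2) (a : Q) (e : ZMod 2 × ZMod 2) :
    sympForm v (Pi.single a e) = siteForm (v a) e := by
  rw [sympForm, Finset.sum_eq_single a]
  · simp
  · intro b _ hb
    simp [Pi.single_eq_of_ne hb, siteForm]
  · simp

theorem siteForm_nondeg {v : ZMod 2 × ZMod 2} (h : ∀ e, siteForm v e = 0) : v = 0 := by
  have h1 := h (1, 0)
  have h2 := h (0, 1)
  simp only [siteForm, mul_zero, mul_one, zero_add, add_zero] at h1 h2
  exact Prod.ext h2 h1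

theorem pauliOp_ne_zero (v : Q → ZMod 2 × ZMod 2) : pauliOp v ≠ 0 := by
  intro h
  have := pauliOp_sq v
  rw [h, mul_zero] at this
  exact zero_ne_one this

theorem pauliOp_commute_iff (v w : Q → ZMod 2 × ZMod 2) :
    Commute (pauliOp v) (pauliOp w) ↔ sympForm v w = 0 := by
  rw [commute_iff_eq, pauliOp_comm v w, ← sgn_eq_one_iff]
  constructor
  · intro h
    have hne : pauliOp w * pauliOp v ≠ 0 := by
      obtain ⟨γ, hγ, e⟩ := pauliOp_mul w v
      rw [e]
      exact smul_ne_zero (by rintro rfl; simp at hγ) (pauliOp_ne_zero _)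
    have : (sgn (sympForm v w) - 1) • (pauliOp w * pauliOp v) = 0 := by
      rw [sub_smul, h, one_smul, sub_self]
    rcases smul_eq_zero.1 this with h' | h'
    · exact sub_eq_zero.1 h'
    · exact absurd h' hne
  · intro h
    rw [h, one_smul]

theorem vec_eq_zero_of_supportedOn {v : Q → ZMod 2 × ZMod 2} {M : Finset Q}
    (h : SupportedOn (pauliOp v) M) {a : Q} (ha : a ∉ M) : v a = 0 := by
  rw [supportedOn_iff] at h
  refine siteForm_nondeg fun e => ?_
  rw [← sympForm_single v a e, ← pauliOp_commute_iff]
  exact h a ha e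

omit [DecidableEq Q] in
theorem exists_smul_one_of_supportedOn_empty {A : Op Q} (h : SupportedOn A ∅) :
    ∃ c : ℂ, A = c • 1 := by
  refine ⟨A 0 0, ?_⟩
  ext s t
  by_cases hst : s = t
  · subst hst
    rw [Matrix.smul_apply, Matrix.one_apply_eq, smul_eq_mul, mul_one]
    exact h.entry_eq (by simp) (by simp) (by simp) (by simp)
  · rw [h.entry_zero (by simpa [← funext_iff] using hst), Matrix.smul_apply,
      Matrix.one_apply_ne hst, smul_zero]

/-- An operator commuting with all Pauli operators is a scalar. -/
theorem exists_smul_one_of_commute {A : Op Q} (h : ∀ v, Commute A (pauliOp v)) :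
    ∃ c : ℂ, A = c • 1 :=
  exists_smul_one_of_supportedOn_empty ((supportedOn_iff _ _).2 fun _ _ _ => h _)

/-- A unitary whose conjugation action fixes all Pauli operators up to a scalar is Pauli. -/
theorem isPauli_of_conj {U : UOp Q}
    (h : ∀ v, ∃ c : ℂ, (U : Op Q) * pauliOp v = c • (pauliOp v * (U : Op Q))) :
    IsPauli (U : Op Q) := by
  have hU : star (U : Op Q) * (U : Op Q) = 1 := Unitary.coe_star_mul_self U
  have hU' : (U : Op Q) * star (U : Op Q) = 1 := Unitary.coe_mul_star_self U
  have hne : ∀ v, pauliOp v * (U : Op Q) ≠ 0 := by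
    intro v h0
    refine pauliOp_ne_zero v ?_
    rw [← mul_one (pauliOp v), ← hU', ← mul_assoc, h0, zero_mul]
  -- The scalar is a sign because a Pauli operator squares to `1`.
  have hs : ∀ v, ∃ c : ZMod 2, (U : Op Q) * pauliOp v = sgn c • (pauliOp v * (U : Op Q)) := by
    intro v
    obtain ⟨c, hc⟩ := h v
    have h2 : (U : Op Q) = (c * c) • (U : Op Q) := by
      calc (U : Op Q) = ((U : Op Q) * pauliOp v) * pauliOp v := by
            rw [mul_assoc, pauliOp_sq, mul_one]
        _ = (c * c) • (pauliOp v * pauliOp v * (U : Op Q)) := by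
            rw [hc, smul_mul_assoc, mul_assoc, hc, mul_smul_comm, smul_smul, mul_assoc]
        _ = _ := by rw [pauliOp_sq, one_mul]
    have h3 : (c * c - 1) • (U : Op Q) = 0 := by
      rw [sub_smul, ← h2, one_smul, sub_self]
    have hU0 : (U : Op Q) ≠ 0 := fun h0 => hne v (by rw [h0, mul_zero])
    have h4 : c * c = 1 := sub_eq_zero.1 ((smul_eq_zero.1 h3).resolve_right hU0)
    rcases mul_self_eq_one_iff.1 h4 with rfl | rfl
    · exact ⟨0, by simpa using hc⟩
    · exact ⟨1, by simpa [sgn] using hc⟩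
  choose c hc using hs
  -- This Pauli has the same commutation signs as `U` with every `X` and `Z`. The coordinates are
  -- swapped because the symplectic form pairs `x` with `z`. Hence `pauliOp v * U` commutes with all
  -- single-qubit Paulis and is a scalar.
  let v : Q → ZMod 2 × ZMod 2 := fun a => (c (Pi.single a (0, 1)), c (Pi.single a (1, 0)))
  have hX : ∀ a, Commute (pauliOp v * (U : Op Q)) (pauliOp (Pi.single a (1, 0))) := by
    intro a
    rw [commute_iff_eq, mul_assoc, hc, mul_smul_comm, ← mul_assoc, pauliOp_comm v,
      sympForm_single, smul_mul_assoc, smul_smul, mul_assoc]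
    have : siteForm (v a) (1, 0) = c (Pi.single a (1, 0)) := by simp [siteForm, v]
    rw [this, ← sgn_add, CharTwo.add_self_eq_zero, sgn_zero, one_smul]
  have hZ : ∀ a, Commute (pauliOp v * (U : Op Q)) (pauliOp (Pi.single a (0, 1))) := by
    intro a
    rw [commute_iff_eq, mul_assoc, hc, mul_smul_comm, ← mul_assoc, pauliOp_comm v,
      sympForm_single, smul_mul_assoc, smul_smul, mul_assoc]
    have : siteForm (v a) (0, 1) = c (Pi.single a (0, 1)) := by simp [siteForm, v]
    rw [this, ← sgn_add, CharTwo.add_self_eq_zero, sgn_zero, one_smul]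
  have hall : ∀ a e, Commute (pauliOp v * (U : Op Q)) (pauliOp (Pi.single a e)) := by
    intro a e
    obtain ⟨x, z⟩ := e
    rcases zmod_two_cases x with rfl | rfl <;> rcases zmod_two_cases z with rfl | rfl
    · have : Pi.single a ((0 : ZMod 2), (0 : ZMod 2)) = (0 : Q → ZMod 2 × ZMod 2) :=
        Pi.single_zero a
      rw [this, pauliOp_zero]
      exact Commute.one_right _
    · exact hZ a
    · exact hX a
    · obtain ⟨γ, hγ, e⟩ := pauliOp_mul (Pi.single a ((1 : ZMod 2), (0 : ZMod 2)))
        (Pi.single a ((0 : ZMod 2), (1 : ZMod 2)))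
      have h11 : (Pi.single a ((1 : ZMod 2), (0 : ZMod 2)) : Q → ZMod 2 × ZMod 2) +
          Pi.single a ((0 : ZMod 2), (1 : ZMod 2)) = Pi.single a (1, 1) := by
        rw [← Pi.single_add]
        simp
      rw [h11] at e
      have hγ0 : γ ≠ 0 := by rintro rfl; simp at hγ
      rw [← inv_smul_smul₀ hγ0 (pauliOp (Pi.single a ((1 : ZMod 2), (1 : ZMod 2)))), ← e]
      exact ((hX a).mul_right (hZ a)).smul_right _
  obtain ⟨d, hd⟩ := exists_smul_one_of_supportedOn_empty
    ((supportedOn_iff (pauliOp v * (U : Op Q)) ∅).2 fun a _ e => hall a e)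
  have hUd : (U : Op Q) = d • pauliOp v := by
    rw [← one_mul (U : Op Q), ← pauliOp_sq v, mul_assoc, hd, mul_smul_comm, mul_one]
  refine (isPauli_iff _).2 ⟨d, ?_, v, hUd⟩
  have h1 : (d * star d) • (1 : Op Q) = 1 := by
    have h2 := hU'
    rwa [hUd, star_smul, smul_mul_smul_comm, Matrix.star_eq_conjTranspose,
      pauliOp_conjTranspose, pauliOp_sq] at h2
  have h2 := congrFun (congrFun h1 0) 0
  simp only [Matrix.smul_apply, Matrix.one_apply_eq, smul_eq_mul, mul_one] at h2
  rw [Complex.star_def, Complex.mul_conj, Complex.normSq_eq_norm_sq] at h2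
  have h3 : ‖d‖ ^ 2 = 1 := by exact_mod_cast h2
  exact (pow_eq_one_iff_of_nonneg (norm_nonneg d) two_ne_zero).1 h3

end

/-! ### The hierarchy of encoded gates -/

section Hierarchy

variable {k : ℕ}

/-- Conjugation by `P` permutes the Pauli group. This lets one pass from a commutator `U * P * star
U * star P` back to the conjugate `U * P * star U`. -/
theorem hierarchy_mul_pauli : ∀ (j : ℕ) {U P : UOp (Fin k)}, U ∈ hierarchy k j →
    IsPauli (P : Op (Fin k)) → U * P ∈ hierarchy k j
  | 0, _, _, hU, _ => hU.elim
  | 1, U, P, hU, hP => by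
    change IsPauli ((U : Op (Fin k)) * (P : Op (Fin k)))
    exact IsPauli.mul hU hP
  | j + 2, U, P, hU, hP => by
    intro R hR
    have h : IsPauli ((P * R * star P : UOp (Fin k)) : Op (Fin k)) :=
      (hP.mul hR).mul hP.star
    have := hU _ h
    rw [star_mul]
    simpa only [mul_assoc] using this

theorem hierarchy_phase_smul : ∀ (j : ℕ) {U V : UOp (Fin k)} {γ : ℂ}, ‖γ‖ = 1 →
    (U : Op (Fin k)) = γ • (V : Op (Fin k)) → V ∈ hierarchy k j → U ∈ hierarchy k j
  | 0, _, _, _, _, _, hV => hV.elim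
  | 1, U, V, γ, hγ, h, hV => by
    change IsPauli (U : Op (Fin k))
    rw [h]
    exact IsPauli.smul hV hγ
  | j + 2, U, V, γ, hγ, h, hV => by
    intro R hR
    have : U * R * star U = V * R * star V := by
      apply Subtype.ext
      change (U : Op (Fin k)) * R * star (U : Op (Fin k)) =
        (V : Op (Fin k)) * R * star (V : Op (Fin k))
      have hγ' : γ * star γ = 1 := by
        rw [Complex.star_def, Complex.mul_conj, Complex.normSq_eq_norm_sq, hγ]
        simp
      rw [h, star_smul, smul_mul_assoc, smul_mul_smul_comm, hγ', one_smul]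
    rw [this]
    exact hV R hR

theorem finite_pauli_up_to_phase : FiniteUpToPhase {U : UOp (Fin k) | IsPauli (U : Op (Fin k))} := by
  refine ⟨Set.range pauliU, Set.finite_range _, fun U hU => ?_⟩
  obtain ⟨γ, hγ, v, h⟩ := (isPauli_iff _).1 hU
  exact ⟨_, ⟨v, rfl⟩, γ, hγ, h⟩

/-- The product `star V * U` commutes with each Pauli up to a scalar, so `isPauli_of_conj` applies.
-/
theorem isPauli_star_mul_of_conj {U V : UOp (Fin k)}
    (h : ∀ v, ∃ c : ℂ, (U : Op (Fin k)) * pauliOp v * star (U : Op (Fin k)) =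
      c • ((V : Op (Fin k)) * pauliOp v * star (V : Op (Fin k)))) :
    IsPauli ((star V * U : UOp (Fin k)) : Op (Fin k)) := by
  refine isPauli_of_conj fun v => ?_
  obtain ⟨c, hc⟩ := h v
  refine ⟨c, ?_⟩
  have hU : star (U : Op (Fin k)) * (U : Op (Fin k)) = 1 := Unitary.coe_star_mul_self U
  have hV : star (V : Op (Fin k)) * (V : Op (Fin k)) = 1 := Unitary.coe_star_mul_self V
  change star (V : Op (Fin k)) * (U : Op (Fin k)) * pauliOp v =
    c • (pauliOp v * (star (V : Op (Fin k)) * (U : Op (Fin k))))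
  calc star (V : Op (Fin k)) * (U : Op (Fin k)) * pauliOp v
      = star (V : Op (Fin k)) * ((U : Op (Fin k)) * pauliOp v * star (U : Op (Fin k))) *
          (U : Op (Fin k)) := by
        simp only [mul_assoc, hU, mul_one]
    _ = c • ((star (V : Op (Fin k)) * (V : Op (Fin k))) * pauliOp v *
          (star (V : Op (Fin k)) * (U : Op (Fin k)))) := by
        rw [hc]
        simp only [mul_assoc, mul_smul_comm, smul_mul_assoc]
    _ = _ := by rw [hV, one_mul]

/-- Conjugation by a unitary of level `j + 2` assigns to each Pauli label one of finitely many
representatives of level `j + 1`. Two unitaries with the same assignment `f` differ by a Pauli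
factor on the right, so one choice of `rep f` for each `f`, times all Paulis, exhausts the level up
to phase. -/
theorem finiteUpToPhase_hierarchy : ∀ j : ℕ, FiniteUpToPhase (hierarchy k j)
  | 0 => ⟨∅, Set.finite_empty, fun _ h => h.elim⟩
  | 1 => finite_pauli_up_to_phase
  | j + 2 => by
    classical
    obtain ⟨F, hF, hFj⟩ := finiteUpToPhase_hierarchy (j + 1)
    let good : UOp (Fin k) → ((Fin k → ZMod 2 × ZMod 2) → F) → Prop := fun U f => ∀ v,
      ∃ c : ℂ, ‖c‖ = 1 ∧
        (U : Op (Fin k)) * pauliOp v * star (U : Op (Fin k)) = c • ((f v).1 : Op (Fin k))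
    have hgood : ∀ U ∈ hierarchy k (j + 2), ∃ f, good U f := by
      intro U hU
      have : ∀ v, ∃ V : F, ∃ c : ℂ, ‖c‖ = 1 ∧
          (U : Op (Fin k)) * pauliOp v * star (U : Op (Fin k)) = c • (V.1 : Op (Fin k)) := by
        intro v
        obtain ⟨V, hV, c, hc, e⟩ := hFj _ (hU (pauliU v) (isPauli_pauliOp v))
        exact ⟨⟨V, hV⟩, c, hc, e⟩
      choose f hf using this
      exact ⟨f, hf⟩
    -- The default `1` is never relevant: `rep` is used only for an `f` realized by some unitary.
    let rep : ((Fin k → ZMod 2 × ZMod 2) → F) → UOp (Fin k) := fun f =>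
      if h : ∃ U, good U f then h.choose else 1
    have : Finite F := hF
    refine ⟨Set.range fun x : ((Fin k → ZMod 2 × ZMod 2) → F) × (Fin k → ZMod 2 × ZMod 2) =>
      rep x.1 * pauliU x.2, Set.finite_range _, fun U hU => ?_⟩
    obtain ⟨f, hf⟩ := hgood U hU
    have hex : ∃ U, good U f := ⟨U, hf⟩
    have hrep : good (rep f) f := by
      simp only [rep, dif_pos hex]
      exact hex.choose_spec
    have hP : IsPauli ((star (rep f) * U : UOp (Fin k)) : Op (Fin k)) := by
      refine isPauli_star_mul_of_conj fun v => ?_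
      obtain ⟨c, hc, e⟩ := hf v
      obtain ⟨d, hd, e'⟩ := hrep v
      have hd0 : d ≠ 0 := by rintro rfl; simp at hd
      exact ⟨c * d⁻¹, by rw [e, e', smul_smul, inv_mul_cancel_right₀ hd0]⟩
    obtain ⟨γ, hγ, w, e⟩ := (isPauli_iff _).1 hP
    refine ⟨_, ⟨(f, w), rfl⟩, γ, hγ, ?_⟩
    change (U : Op (Fin k)) = γ • ((rep f : Op (Fin k)) * pauliOp w)
    rw [← mul_smul_comm, ← e]
    change (U : Op (Fin k)) = (rep f : Op (Fin k)) * (star (rep f : Op (Fin k)) * (U : Op (Fin k)))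
    have h1 : (rep f : Op (Fin k)) * star (rep f : Op (Fin k)) = 1 :=
      Unitary.coe_mul_star_self (rep f)
    rw [← mul_assoc, h1, one_mul]

/-- The quantity `φ` is invariant under phases, so it takes finitely many values on the generated
group. Universality would make these values dense in the unit circle. -/
theorem not_isUniversal_of_finiteUpToPhase (hk : 1 ≤ k) {A H : Set (UOp (Fin k))}
    (hH : FiniteUpToPhase H) (hA : (Subgroup.closure A : Set (UOp (Fin k))) ⊆ H) :
    ¬ IsUniversal A := by
  intro hU
  obtain ⟨F, hF, hFH⟩ := hH
  let s : Fin k → Fin 2 := fun _ => 0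
  let t : Fin k → Fin 2 := fun _ => 1
  have hst : s ≠ t := fun h => zero_ne_one (congrFun h ⟨0, hk⟩)
  let φ : UOp (Fin k) → ℂ := fun W => (W : Op (Fin k)) s s * star ((W : Op (Fin k)) t t)
  have hfin : (φ '' F).Finite := hF.image φ
  have hcircle : ∀ z : ℂ, ‖z‖ = 1 → z ∈ φ '' F := by
    intro z hz
    rw [← hfin.isClosed.closure_eq, Metric.mem_closure_iff]
    intro ε hε
    -- A test unitary with `φ V = z`. Its two relevant entries are approximated within `ε / 3` each,
    -- and the two errors add up in `φ`.
    let V : UOp (Fin k) := ⟨Matrix.diagonal fun x => if x = s then z else 1, by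
      rw [Matrix.mem_unitaryGroup_iff, Matrix.star_eq_conjTranspose,
        Matrix.diagonal_conjTranspose, Matrix.diagonal_mul_diagonal, ← Matrix.diagonal_one]
      congr 1
      funext x
      by_cases hx : x = s
      · simp [hx, Complex.mul_conj, Complex.normSq_eq_norm_sq, hz]
      · simp [hx]⟩
    obtain ⟨W, hW, γ, hγ, hVW⟩ := hU V (ε / 3) (by positivity)
    obtain ⟨W', hW', δ, hδ, e⟩ := hFH W (hA hW)
    refine ⟨φ W', ⟨W', hW', rfl⟩, ?_⟩
    have h1 := hVW s s
    have h2 := hVW t t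
    have hVs : (V : Op (Fin k)) s s = z := by simp [V]
    have hVt : (V : Op (Fin k)) t t = 1 := by simp [V, hst.symm]
    rw [hVs, e, Matrix.smul_apply] at h1
    rw [hVt, e, Matrix.smul_apply] at h2
    have hW1 : ‖(W' : Op (Fin k)) s s‖ ≤ 1 := entry_norm_bound_of_unitary W'.2 s s
    set a := (W' : Op (Fin k)) s s
    set b := (W' : Op (Fin k)) t t
    have hφ : φ W' = (γ * δ • a) * star (γ * δ • b) := by
      have hγ' : γ * star γ = 1 := by
        rw [Complex.star_def, Complex.mul_conj, Complex.normSq_eq_norm_sq, hγ]; simp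
      have hδ' : δ * star δ = 1 := by
        rw [Complex.star_def, Complex.mul_conj, Complex.normSq_eq_norm_sq, hδ]; simp
      simp only [φ, smul_eq_mul, star_mul]
      linear_combination (-(a * star b) * (δ * star δ)) * hγ' - (a * star b) * hδ'
    set a' := γ * δ • a
    set b' := γ * δ • b
    have ha' : ‖a'‖ ≤ 1 := by simpa [a', hγ, hδ] using hW1
    rw [hφ, dist_eq_norm]
    calc ‖z - a' * star b'‖ = ‖(z - a') + a' * star (1 - b')‖ := by
          congr 1; rw [star_sub, star_one]; ring
      _ ≤ ‖z - a'‖ + ‖a' * star (1 - b')‖ := norm_add_le _ _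
      _ = ‖z - a'‖ + ‖a'‖ * ‖1 - b'‖ := by rw [norm_mul, norm_star]
      _ ≤ ‖z - a'‖ + 1 * ‖1 - b'‖ := by gcongr
      _ < ε := by linarith
  have hsub : Metric.sphere (0 : ℂ) 1 ⊆ φ '' F := fun z hz => hcircle z (by simpa using hz)
  have : (Metric.sphere (0 : ℂ) 1).Infinite := by
    have : Infinite (Set.Ioc (-Real.pi) Real.pi) :=
      (Set.Ioc_infinite (by linarith [Real.pi_pos])).to_subtype
    have : Infinite Circle := Infinite.of_injective _ Circle.argEquiv.symm.injective
    exact Set.infinite_of_injective_forall_mem (f := fun z : Circle => (z : ℂ))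
      Circle.coe_injective fun z => by simp [Circle.norm_coe]
  exact this (hfin.subset hsub)

end Hierarchy

/-! ### Logical operators of stabilizer codes -/

section Codes

variable {Q : Type} [Fintype Q] [DecidableEq Q] {C : StabilizerCode Q}

theorem star_mul_coe (U : UOp Q) : star (U : Op Q) * (U : Op Q) = 1 := Unitary.coe_star_mul_self U

theorem coe_mul_star (U : UOp Q) : (U : Op Q) * star (U : Op Q) = 1 := Unitary.coe_mul_star_self U

/-- `A` acts on the codespace as a scalar. -/
def StabilizerCode.ActsAsScalar (C : StabilizerCode Q) (A : Op Q) : Prop :=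
  ∃ c : ℂ, ∀ ψ ∈ C.codespace, A.mulVec ψ = c • ψ

/-- The set `M` is correctable: every logical Pauli operator supported on `M` is trivial. -/
def StabilizerCode.Correctable (C : StabilizerCode Q) (M : Finset Q) : Prop :=
  ∀ v : Q → ZMod 2 × ZMod 2, (∀ a ∉ M, v a = 0) →
    (∀ S ∈ C.stab, Commute (pauliOp v) (S : Op Q)) → C.ActsAsScalar (pauliOp v)

theorem StabilizerCode.IsLogical.mulVec_mem {U : UOp Q} (hU : C.IsLogical U)
    {ψ : (Q → Fin 2) → ℂ} (hψ : ψ ∈ C.codespace) : (U : Op Q).mulVec ψ ∈ C.codespace := by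
  rw [StabilizerCode.IsLogical] at hU
  rw [← hU]
  exact Submodule.mem_map_of_mem (f := (U : Op Q).mulVecLin) hψ

theorem isLogical_star {U : UOp Q} (hU : C.IsLogical U) : C.IsLogical (star U) := by
  unfold StabilizerCode.IsLogical at hU ⊢
  conv_lhs => rw [← hU]
  rw [← Submodule.map_comp, ← Matrix.mulVecLin_mul]
  change Submodule.map (star (U : Op Q) * (U : Op Q)).mulVecLin _ = _
  rw [star_mul_coe, Matrix.mulVecLin_one, Submodule.map_id]

theorem isLogical_mul {U V : UOp Q} (hU : C.IsLogical U) (hV : C.IsLogical V) :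
    C.IsLogical (U * V) := by
  unfold StabilizerCode.IsLogical at hU hV ⊢
  change Submodule.map ((U : Op Q) * (V : Op Q)).mulVecLin _ = _
  rw [Matrix.mulVecLin_mul, Submodule.map_comp, hV, hU]

theorem isLogical_one : C.IsLogical 1 := by
  unfold StabilizerCode.IsLogical
  change Submodule.map (1 : Op Q).mulVecLin _ = _
  rw [Matrix.mulVecLin_one, Submodule.map_id]

theorem isLogical_of_commute {U : UOp Q} (h : ∀ S ∈ C.stab, Commute (U : Op Q) (S : Op Q)) :
    C.IsLogical U := by
  have key : ∀ V : UOp Q, (∀ S ∈ C.stab, Commute (V : Op Q) (S : Op Q)) →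
      C.codespace.map (V : Op Q).mulVecLin ≤ C.codespace := by
    rintro V hV _ ⟨ψ, hψ, rfl⟩ S hS
    rw [Matrix.mulVecLin_apply, Matrix.mulVec_mulVec, ← (hV S hS).eq, ← Matrix.mulVec_mulVec,
      hψ S hS]
  refine le_antisymm (key U h) fun ψ hψ => ?_
  have h' : ∀ S ∈ C.stab, Commute ((star U : UOp Q) : Op Q) (S : Op Q) := by
    intro S hS
    have := (h _ (C.stab.inv_mem hS)).star_star
    change Commute (star (U : Op Q)) (star (star (S : Op Q))) at this
    rwa [star_star] at this
  refine ⟨(star (U : Op Q)).mulVec ψ,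
    key (star U) h' (Submodule.mem_map_of_mem (f := ((star U : UOp Q) : Op Q).mulVecLin) hψ), ?_⟩
  rw [Matrix.mulVecLin_apply, Matrix.mulVec_mulVec, coe_mul_star, Matrix.one_mulVec]

/-- Two Paulis commute up to a scalar. Comparing both products on a nonzero code vector, which the
stabilizer fixes before and after `P` acts, forces the scalar to be `1`. -/
theorem commute_of_isLogical (hC : C.codespace ≠ ⊥) {P : UOp Q} (hP : IsPauli (P : Op Q))
    (hL : C.IsLogical P) {S : UOp Q} (hS : S ∈ C.stab) : Commute (P : Op Q) (S : Op Q) := by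
  obtain ⟨γ, hγ⟩ := pauli_comm_phase hP (C.isPauli S hS)
  obtain ⟨ψ, hψ, hne⟩ := Submodule.exists_mem_ne_zero_of_ne_bot hC
  have h1 : (P : Op Q).mulVec ψ = γ • (P : Op Q).mulVec ψ := by
    conv_lhs => rw [← hψ S hS]
    rw [Matrix.mulVec_mulVec, hγ, Matrix.smul_mulVec, ← Matrix.mulVec_mulVec,
      hL.mulVec_mem hψ S hS]
  have h2 : (P : Op Q).mulVec ψ ≠ 0 := by
    intro h0
    apply hne
    rw [← Matrix.one_mulVec ψ, ← star_mul_coe P, ← Matrix.mulVec_mulVec, h0, Matrix.mulVec_zero]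
  have h3 : (1 - γ) • (P : Op Q).mulVec ψ = 0 := by
    rw [sub_smul, one_smul, ← h1, sub_self]
  have h4 : γ = 1 := (sub_eq_zero.1 ((smul_eq_zero.1 h3).resolve_right h2)).symm
  rw [commute_iff_eq, hγ, h4, one_smul]

/-! ### Symplectic duality, the cleaning lemma and the union lemma. -/

/-- The binary vectors labelling the stabilizers. -/
def StabilizerCode.stabVec (C : StabilizerCode Q) : Submodule (ZMod 2) (Q → ZMod 2 × ZMod 2) where
  carrier := {v | ∃ S ∈ C.stab, ∃ γ : ℂ, ‖γ‖ = 1 ∧ (S : Op Q) = γ • pauliOp v}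
  add_mem' := by
    rintro v w ⟨S, hS, γ, hγ, e⟩ ⟨T, hT, δ, hδ, e'⟩
    obtain ⟨ε, hε, e''⟩ := pauliOp_mul v w
    refine ⟨S * T, C.stab.mul_mem hS hT, γ * δ * ε, by simp [hγ, hδ, hε], ?_⟩
    change (S : Op Q) * (T : Op Q) = _
    rw [e, e', smul_mul_smul_comm, e'', smul_smul]
  zero_mem' := ⟨1, C.stab.one_mem, 1, by simp, by
    rw [pauliOp_zero, one_smul]; rfl⟩
  smul_mem' := by
    rintro c v hv
    rcases zmod_two_cases c with rfl | rfl
    · rw [zero_smul]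
      exact ⟨1, C.stab.one_mem, 1, by simp, by rw [pauliOp_zero, one_smul]; rfl⟩
    · rwa [one_smul]

theorem exists_sympForm_eq (f : (Q → ZMod 2 × ZMod 2) →ₗ[ZMod 2] ZMod 2) :
    ∃ x, ∀ w, f w = sympForm w x := by
  refine ⟨fun a => (f (Pi.single a (0, 1)), f (Pi.single a (1, 0))), fun w => ?_⟩
  have h1 : w = ∑ a, ((w a).1 • (Pi.single a (1, 0) : Q → ZMod 2 × ZMod 2) +
      (w a).2 • (Pi.single a (0, 1) : Q → ZMod 2 × ZMod 2)) := by
    conv_lhs => rw [← Finset.univ_sum_single w]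
    refine Finset.sum_congr rfl fun a _ => ?_
    rw [← Pi.single_smul, ← Pi.single_smul, ← Pi.single_add]
    simp
  conv_lhs => rw [h1]
  rw [map_sum, sympForm]
  refine Finset.sum_congr rfl fun a _ => ?_
  rw [map_add, map_smul, map_smul]
  rfl

/-- The vectors vanishing on `M`. -/
def vanishingOn (M : Finset Q) : Submodule (ZMod 2) (Q → ZMod 2 × ZMod 2) where
  carrier := {v | ∀ a ∈ M, v a = 0}
  add_mem' := by
    intro v w hv hw a ha
    rw [Pi.add_apply, hv a ha, hw a ha, add_zero]
  zero_mem' := fun _ _ => rfl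
  smul_mem' := by
    intro c v hv a ha
    rw [Pi.smul_apply, hv a ha, smul_zero]

theorem commute_of_actsAsScalar (hC : C.codespace ≠ ⊥) {v w : Q → ZMod 2 × ZMod 2}
    (hv : ∀ S ∈ C.stab, Commute (pauliOp v) (S : Op Q)) (hw : C.ActsAsScalar (pauliOp w)) :
    sympForm v w = 0 := by
  obtain ⟨c, hc⟩ := hw
  have hL : C.IsLogical (pauliU v) := isLogical_of_commute hv
  obtain ⟨ψ, hψ, hne⟩ := Submodule.exists_mem_ne_zero_of_ne_bot hC
  have h0 : ∀ u : Q → ZMod 2 × ZMod 2, ∀ φ : (Q → Fin 2) → ℂ, φ ≠ 0 →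
      (pauliOp u).mulVec φ ≠ 0 := by
    intro u φ hφ h0
    apply hφ
    rw [← Matrix.one_mulVec φ, ← pauliOp_sq u, ← Matrix.mulVec_mulVec, h0, Matrix.mulVec_zero]
  have h1 : (pauliOp v * pauliOp w).mulVec ψ = (pauliOp w * pauliOp v).mulVec ψ := by
    have h := hc _ (hL.mulVec_mem hψ)
    rw [coe_pauliU] at h
    rw [← Matrix.mulVec_mulVec, ← Matrix.mulVec_mulVec, hc ψ hψ, h, Matrix.mulVec_smul]
  rw [pauliOp_comm v w, Matrix.smul_mulVec] at h1
  have h2 : (pauliOp w * pauliOp v).mulVec ψ ≠ 0 := by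
    rw [← Matrix.mulVec_mulVec]
    exact h0 _ _ (h0 _ _ hne)
  have h3 : (sgn (sympForm v w) - 1) • (pauliOp w * pauliOp v).mulVec ψ = 0 := by
    rw [sub_smul, h1, one_smul, sub_self]
  exact (sgn_eq_one_iff _).1 (sub_eq_zero.1 ((smul_eq_zero.1 h3).resolve_right h2))

theorem commute_stab_of_sympForm {x : Q → ZMod 2 × ZMod 2}
    (h : ∀ s ∈ C.stabVec, sympForm s x = 0) (S : UOp Q) (hS : S ∈ C.stab) :
    Commute (pauliOp x) (S : Op Q) := by
  obtain ⟨γ, hγ, s, e⟩ := (isPauli_iff _).1 (C.isPauli S hS)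
  rw [e]
  refine Commute.smul_right ?_ _
  rw [pauliOp_commute_iff, sympForm_comm]
  exact h s ⟨S, hS, γ, hγ, e⟩

/-- The cleaning lemma: a logical Pauli operator can be multiplied by a stabilizer so that the
product acts trivially on a given correctable set. -/
theorem exists_stabVec_add_eq_zero (hC : C.codespace ≠ ⊥) {M : Finset Q} (hM : C.Correctable M)
    {v : Q → ZMod 2 × ZMod 2} (hv : ∀ S ∈ C.stab, Commute (pauliOp v) (S : Op Q)) :
    ∃ s ∈ C.stabVec, ∀ a ∈ M, (v + s) a = 0 := by
  by_cases hmem : v ∈ C.stabVec ⊔ vanishingOn M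
  · obtain ⟨s, hs, w, hw, rfl⟩ := Submodule.mem_sup.1 hmem
    refine ⟨s, hs, fun a ha => ?_⟩
    rw [Pi.add_apply, Pi.add_apply, hw a ha, add_zero]
    exact Prod.ext (CharTwo.add_self_eq_zero _) (CharTwo.add_self_eq_zero _)
  · exfalso
    -- A functional separating `v` from the sum is pairing with some `x`. Vanishing on `vanishingOn
    -- M` makes `x` supported on `M`, and vanishing on `stabVec` makes it commute with the
    -- stabilizers. Correctability makes `pauliOp x` a scalar on the code, so it commutes with
    -- `pauliOp v`, contradicting `hfv`.
    obtain ⟨f, hfv, hf⟩ := Submodule.exists_le_ker_of_notMem hmem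
    obtain ⟨x, hx⟩ := exists_sympForm_eq f
    have hxM : ∀ a ∉ M, x a = 0 := by
      intro a ha
      refine siteForm_nondeg fun e => ?_
      rw [← sympForm_single, sympForm_comm, ← hx]
      refine hf (Submodule.mem_sup_right fun b hb => ?_)
      exact Pi.single_eq_of_ne (by rintro rfl; exact ha hb) _
    have hxS := commute_stab_of_sympForm (C := C) (x := x)
      fun s hs => by rw [← hx]; exact hf (Submodule.mem_sup_left hs)
    exact hfv (by rw [hx]; exact commute_of_actsAsScalar hC hv (hM x hxM hxS))

theorem actsAsScalar_add {v w : Q → ZMod 2 × ZMod 2} (hv : C.ActsAsScalar (pauliOp v))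
    (hw : C.ActsAsScalar (pauliOp w)) : C.ActsAsScalar (pauliOp (v + w)) := by
  obtain ⟨c, hc⟩ := hv
  obtain ⟨d, hd⟩ := hw
  obtain ⟨γ, hγ, e⟩ := pauliOp_mul v w
  have hγ0 : γ ≠ 0 := by rintro rfl; simp at hγ
  refine ⟨γ⁻¹ * (d * c), fun ψ hψ => ?_⟩
  rw [← inv_smul_smul₀ hγ0 (pauliOp (v + w)), ← e, Matrix.smul_mulVec, ← Matrix.mulVec_mulVec,
    hd ψ hψ, Matrix.mulVec_smul, hc ψ hψ, smul_smul, smul_smul, mul_assoc]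

theorem actsAsScalar_sum {ι : Type} (F : Finset ι) (v : ι → Q → ZMod 2 × ZMod 2)
    (h : ∀ i ∈ F, C.ActsAsScalar (pauliOp (v i))) : C.ActsAsScalar (pauliOp (∑ i ∈ F, v i)) := by
  classical
  induction F using Finset.induction_on with
  | empty => exact ⟨1, fun ψ _ => by simp [pauliOp_zero]⟩
  | insert a F ha ih =>
    rw [Finset.sum_insert ha]
    exact actsAsScalar_add (h a (Finset.mem_insert_self _ _))
      (ih fun i hi => h i (Finset.mem_insert_of_mem hi))

/-- The union lemma: a set is correctable if it is partitioned into correctable pieces such that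
no generator of the stabilizer group touches two pieces. -/
theorem correctable_of_pieces {ι : Type} [DecidableEq ι] {M : Finset Q} (f : Q → ι)
    {G : Set (UOp Q)} (hG : Subgroup.closure G = C.stab)
    (hGf : ∀ S ∈ G, ∃ N : Finset Q, SupportedOn (S : Op Q) N ∧
      ∀ a ∈ M, ∀ b ∈ M, a ∈ N → b ∈ N → f a = f b)
    (hM : ∀ i, C.Correctable (M.filter fun a => f a = i)) : C.Correctable M := by
  intro v hv hvS
  let part : ι → Q → ZMod 2 × ZMod 2 := fun i a => if f a = i then v a else 0
  have hsum : v = ∑ i ∈ Finset.univ.image f, part i := by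
    funext a
    rw [Finset.sum_apply]
    simp [part]
  rw [hsum]
  refine actsAsScalar_sum _ _ fun i _ => hM i _ ?_ ?_
  · intro a ha
    simp only [part]
    split_ifs with h
    · exact hv a fun h' => ha (Finset.mem_filter.2 ⟨h', h⟩)
    · rfl
  · intro S hS
    rw [← hG] at hS
    induction hS using Subgroup.closure_induction with
    | mem S hSG =>
      have hS : S ∈ C.stab := hG ▸ Subgroup.subset_closure hSG
      obtain ⟨γ, hγ, s, e⟩ := (isPauli_iff _).1 (C.isPauli S hS)
      have hγ0 : γ ≠ 0 := by rintro rfl; simp at hγ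
      obtain ⟨N, hSN, hN⟩ := hGf S hSG
      have hsN : ∀ a ∉ N, s a = 0 := by
        have : SupportedOn (pauliOp s) N := by
          rw [← inv_smul_smul₀ hγ0 (pauliOp s), ← e]
          exact hSN.smul _
        exact fun a ha => vec_eq_zero_of_supportedOn this ha
      have h0 : sympForm v s = 0 := by
        rw [← pauliOp_commute_iff, ← inv_smul_smul₀ hγ0 (pauliOp s), ← e]
        exact (hvS S hS).smul_right _
      rw [e]
      refine Commute.smul_right ((pauliOp_commute_iff _ _).2 ?_) _
      have hz : ∀ e, siteForm 0 e = 0 := fun e => by simp [siteForm]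
      have hz' : ∀ e, siteForm e 0 = 0 := fun e => by simp [siteForm]
      -- A generator meets at most one piece of `M`. If that is piece `i`, its form with `part i`
      -- equals its form with all of `v`, which is zero; otherwise `part i` and the generator have
      -- no common site.
      by_cases hex : ∃ a ∈ M, a ∈ N ∧ f a = i
      · obtain ⟨a, haM, haN, hai⟩ := hex
        rw [← h0]
        refine Finset.sum_congr rfl fun b _ => ?_
        by_cases hbN : b ∈ N
        · by_cases hbM : b ∈ M
          · have : f b = i := (hN b hbM a haM hbN haN).trans hai
            simp [part, this]
          · simp [part, hv b hbM]
        · rw [hsN b hbN, hz', hz']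
      · push Not at hex
        refine Finset.sum_eq_zero fun b _ => ?_
        by_cases hbN : b ∈ N
        · by_cases hbM : b ∈ M
          · simp [part, hex b hbM hbN, hz]
          · simp [part, hv b hbM, hz]
        · rw [hsN b hbN, hz']
    | one => exact Commute.one_right _
    | mul S T _ _ hS hT => exact hS.mul_right hT
    | inv S _ hS =>
      have := hS.star_star
      rw [Matrix.star_eq_conjTranspose (pauliOp _), pauliOp_conjTranspose] at this
      exact this

theorem correctable_of_card_lt {d : ℕ} (hd : C.HasDistance d) {M : Finset Q} (hM : M.card < d) :
    C.Correctable M := fun v hv hvS =>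
  hd (pauliU v) (isPauli_pauliOp v) (isLogical_of_commute hvS) ⟨M, hM, supportedOn_pauliOp hv⟩

theorem codespace_ne_bot {k : ℕ} (h : C.HasLogicalQubits k) : C.codespace ≠ ⊥ := by
  intro h0
  rw [StabilizerCode.HasLogicalQubits, h0, finrank_bot] at h
  exact (pow_pos two_pos k).ne h

/-! ### Encoded operators -/

variable {k : ℕ} {J : Matrix (Q → Fin 2) (Fin k → Fin 2) ℂ}

theorem StabilizerCode.IsEncoding.mulVec_mem (hJ : C.IsEncoding J) (φ : (Fin k → Fin 2) → ℂ) :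
    J.mulVec φ ∈ C.codespace := by
  rw [← hJ.range_eq]
  exact ⟨φ, rfl⟩

/-- `J * J.conjTranspose` projects onto the codespace, which contains the range of `A * J`. It can
therefore be inserted between factors, which makes `encoded` multiplicative. -/
theorem StabilizerCode.IsEncoding.proj_mul (hJ : C.IsEncoding J) {A : Op Q}
    (hA : ∀ ψ ∈ C.codespace, A.mulVec ψ ∈ C.codespace) :
    J * J.conjTranspose * (A * J) = A * J := by
  apply Matrix.ext_of_mulVec_single
  intro i
  rw [← Matrix.mulVec_mulVec]
  have h := hA _ (hJ.mulVec_mem (Pi.single i 1))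
  rw [← hJ.range_eq] at h
  obtain ⟨φ, hφ⟩ := h
  rw [Matrix.mulVecLin_apply] at hφ
  rw [← Matrix.mulVec_mulVec (Pi.single i 1) A J, ← hφ, Matrix.mulVec_mulVec, Matrix.mul_assoc,
    hJ.isometry, Matrix.mul_one]

theorem StabilizerCode.IsEncoding.encoded_mul (hJ : C.IsEncoding J) (A : Op Q) {U : UOp Q}
    (hU : C.IsLogical U) : encoded J (A * (U : Op Q)) = encoded J A * encoded J (U : Op Q) := by
  unfold encoded
  have h := hJ.proj_mul fun ψ hψ => hU.mulVec_mem hψ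
  calc J.conjTranspose * (A * (U : Op Q)) * J = J.conjTranspose * A * ((U : Op Q) * J) := by
        simp only [Matrix.mul_assoc]
    _ = _ := by
        rw [← h]
        simp only [Matrix.mul_assoc]

theorem encoded_star (A : Op Q) : encoded J (star A) = star (encoded J A) := by
  simp only [encoded, Matrix.star_eq_conjTranspose, Matrix.conjTranspose_mul,
    Matrix.conjTranspose_conjTranspose, Matrix.mul_assoc]

theorem StabilizerCode.IsEncoding.encoded_one (hJ : C.IsEncoding J) :
    encoded J (1 : Op Q) = 1 := by
  rw [encoded, Matrix.mul_one, hJ.isometry]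

theorem StabilizerCode.IsEncoding.encoded_mem_unitary (hJ : C.IsEncoding J) {U : UOp Q}
    (hU : C.IsLogical U) : encoded J (U : Op Q) ∈ UOp (Fin k) := by
  rw [Matrix.mem_unitaryGroup_iff', ← encoded_star, ← hJ.encoded_mul _ hU, star_mul_coe,
    hJ.encoded_one]

/-- The encoded gate of a logical operator, as a unitary on `k` qubits. -/
def encodedU (hJ : C.IsEncoding J) (U : UOp Q) (hU : C.IsLogical U) : UOp (Fin k) :=
  ⟨encoded J (U : Op Q), hJ.encoded_mem_unitary hU⟩

theorem StabilizerCode.IsEncoding.encoded_mul_stab (hJ : C.IsEncoding J) (A : Op Q) {S : UOp Q}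
    (hS : S ∈ C.stab) : encoded J (A * (S : Op Q)) = encoded J A := by
  have h : (S : Op Q) * J = J := by
    apply Matrix.ext_of_mulVec_single
    intro i
    rw [← Matrix.mulVec_mulVec]
    exact hJ.mulVec_mem _ S hS
  unfold encoded
  rw [Matrix.mul_assoc, Matrix.mul_assoc, h, Matrix.mul_assoc]

/-- A Pauli lift of `σ` may be multiplied by a stabilizer without changing its encoded action; the
cleaning lemma supplies a stabilizer that clears `M`. -/
theorem StabilizerCode.IsEncoding.exists_cleaned_pauli (hJ : C.IsEncoding J)
    (hC : C.codespace ≠ ⊥) {M : Finset Q} (hM : C.Correctable M) {σ : Op (Fin k)}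
    (hσ : IsPauli σ) :
    ∃ P : UOp Q, IsPauli (P : Op Q) ∧ C.IsLogical P ∧ SupportedOn (P : Op Q) Mᶜ ∧
      encoded J (P : Op Q) = σ := by
  have hmem : σ ∈ {A : Op (Fin k) | IsPauli A} := hσ
  rw [hJ.pauli] at hmem
  obtain ⟨P, hP, hL, rfl⟩ := hmem
  obtain ⟨γ, hγ, v, e⟩ := (isPauli_iff _).1 hP
  have hγ0 : γ ≠ 0 := by rintro rfl; simp at hγ
  have hcomm : ∀ S ∈ C.stab, Commute (pauliOp v) (S : Op Q) := by
    intro S hS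
    rw [← inv_smul_smul₀ hγ0 (pauliOp v), ← e]
    exact (commute_of_isLogical hC hP hL hS).smul_left _
  obtain ⟨s, ⟨S, hS, δ, hδ, e'⟩, hs⟩ := exists_stabVec_add_eq_zero hC hM hcomm
  have hLS : C.IsLogical S := isLogical_of_commute fun T hT => congrArg Subtype.val (C.comm S hS T hT)
  refine ⟨P * S, hP.mul (C.isPauli S hS), isLogical_mul hL hLS, ?_, hJ.encoded_mul_stab _ hS⟩
  obtain ⟨ε, hε, e''⟩ := pauliOp_mul v s
  change SupportedOn ((P : Op Q) * (S : Op Q)) Mᶜ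
  rw [e, e', smul_mul_smul_comm, e'', smul_smul]
  refine (supportedOn_pauliOp fun a ha => hs a ?_).smul _
  simpa using ha

/-- A logical operator supported on a correctable set acts as a scalar. -/
theorem StabilizerCode.IsEncoding.encoded_eq_smul_one (hJ : C.IsEncoding J)
    (hC : C.codespace ≠ ⊥) {M : Finset Q} (hM : C.Correctable M) {K : UOp Q}
    (hK : C.IsLogical K) (hKM : SupportedOn (K : Op Q) M) :
    ∃ c : ℂ, encoded J (K : Op Q) = c • 1 := by
  -- Every encoded Pauli has a lift supported off `M`, which commutes with `K`.
  refine exists_smul_one_of_commute fun v => ?_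
  obtain ⟨P, hP, hL, hPM, e⟩ := hJ.exists_cleaned_pauli hC hM (isPauli_pauliOp v)
  rw [commute_iff_eq, ← e, ← hJ.encoded_mul _ hL, ← hJ.encoded_mul _ hK,
    hKM.mul_comm_of_disjoint hPM disjoint_compl_right]

end Codes

/-! ### Local circuits -/

section Circuits

variable {D L r : ℕ}

/-- The sites at distance at most `ρ` from `M`. -/
def thicken (M : Finset (Site D L)) (ρ : ℕ) : Finset (Site D L) :=
  Finset.univ.filter fun a => ∃ b ∈ M, ∀ i, |((a i : ℕ) : ℤ) - ((b i : ℕ) : ℤ)| ≤ (ρ : ℤ)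

theorem mem_thicken {M : Finset (Site D L)} {ρ : ℕ} {a : Site D L} : a ∈ thicken M ρ ↔
    ∃ b ∈ M, ∀ i, |((a i : ℕ) : ℤ) - ((b i : ℕ) : ℤ)| ≤ (ρ : ℤ) := by
  simp [thicken]

theorem subset_thicken (M : Finset (Site D L)) (ρ : ℕ) : M ⊆ thicken M ρ := fun a ha =>
  mem_thicken.2 ⟨a, ha, fun i => by simp⟩

theorem thicken_mono (M : Finset (Site D L)) {ρ σ : ℕ} (h : ρ ≤ σ) :
    thicken M ρ ⊆ thicken M σ := by
  intro a ha
  obtain ⟨b, hb, h'⟩ := mem_thicken.1 ha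
  exact mem_thicken.2 ⟨b, hb, fun i => (h' i).trans (by exact_mod_cast h)⟩

theorem thicken_thicken_subset (M : Finset (Site D L)) (ρ σ : ℕ) :
    thicken (thicken M ρ) σ ⊆ thicken M (ρ + σ) := by
  intro a ha
  obtain ⟨b, hb, h⟩ := mem_thicken.1 ha
  obtain ⟨c, hc, h'⟩ := mem_thicken.1 hb
  refine mem_thicken.2 ⟨c, hc, fun i => ?_⟩
  push_cast
  linarith [abs_sub_le ((a i : ℕ) : ℤ) ((b i : ℕ) : ℤ) ((c i : ℕ) : ℤ), h i, h' i]

/-- Conjugation by `U` enlarges supports by at most `ρ`. -/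
def SpreadsOneWay (U : UOp (Site D L)) (ρ : ℕ) : Prop :=
  ∀ (A : Op (Site D L)) (M : Finset (Site D L)), SupportedOn A M →
    SupportedOn ((U : Op (Site D L)) * A * star (U : Op (Site D L))) (thicken M ρ)

/-- Conjugation by `U` and by its inverse enlarges supports by at most `ρ`. -/
def Spreads (U : UOp (Site D L)) (ρ : ℕ) : Prop := SpreadsOneWay U ρ ∧ SpreadsOneWay (star U) ρ

theorem SpreadsOneWay.mul {U V : UOp (Site D L)} {ρ σ : ℕ} (hU : SpreadsOneWay U ρ)
    (hV : SpreadsOneWay V σ) : SpreadsOneWay (U * V) (ρ + σ) := by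
  intro A M hA
  have := (hU _ _ (hV A M hA)).mono (thicken_thicken_subset M σ ρ)
  rw [add_comm ρ σ]
  change SupportedOn ((U : Op (Site D L)) * (V : Op (Site D L)) * A *
    star ((U : Op (Site D L)) * (V : Op (Site D L)))) _
  rw [star_mul]
  simpa only [mul_assoc] using this

theorem Spreads.mul {U V : UOp (Site D L)} {ρ σ : ℕ} (hU : Spreads U ρ) (hV : Spreads V σ) :
    Spreads (U * V) (ρ + σ) := by
  refine ⟨hU.1.mul hV.1, ?_⟩
  rw [star_mul, add_comm]
  exact hV.2.mul hU.2

theorem Spreads.star {U : UOp (Site D L)} {ρ : ℕ} (hU : Spreads U ρ) : Spreads (star U) ρ :=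
  ⟨hU.2, by rw [star_star]; exact hU.1⟩

/-- Moving a single-qubit Pauli past `P` from the left or past `star P` from the right costs the
same scalar, so conjugation by `P` preserves commutation with it. -/
theorem spreadsOneWay_of_isPauli {P : UOp (Site D L)} (hP : IsPauli (P : Op (Site D L))) :
    SpreadsOneWay P 0 := by
  intro A M hA
  refine SupportedOn.mono ?_ (subset_thicken M 0)
  rw [supportedOn_iff] at hA ⊢
  intro a ha e
  obtain ⟨c, hc⟩ := pauli_comm_phase hP.star (isPauli_pauliOp (Pi.single a e))
  set X := pauliOp (Pi.single a e)
  have h1 : X * (P : Op (Site D L)) = c • ((P : Op (Site D L)) * X) := by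
    calc X * (P : Op (Site D L))
        = (P : Op (Site D L)) * (star (P : Op (Site D L)) * X) * (P : Op (Site D L)) := by
          rw [← mul_assoc, coe_mul_star, one_mul]
      _ = _ := by
          rw [hc, mul_smul_comm, smul_mul_assoc, ← mul_assoc, mul_assoc _ (star _),
            star_mul_coe, mul_one]
  rw [commute_iff_eq, ← mul_assoc X, ← mul_assoc X, h1, mul_assoc, hc, mul_smul_comm, ← mul_assoc,
    mul_assoc (P : Op (Site D L)) A X, (hA a ha e).eq, smul_mul_assoc, smul_mul_assoc, mul_assoc,
    mul_assoc, mul_assoc, mul_assoc]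

theorem spreads_of_isPauli {P : UOp (Site D L)} (hP : IsPauli (P : Op (Site D L))) :
    Spreads P 0 :=
  ⟨spreadsOneWay_of_isPauli hP, spreadsOneWay_of_isPauli (P := star P) hP.star⟩

/-- A gate that misses `M` is also disjoint from the other gates, so it commutes with the operator
conjugated so far and cancels. A gate that meets `M` adds only its own support. The exact set is
tracked, since a bound by thickenings would accumulate along the list. -/
theorem spreadsOneWay_gates : ∀ gates : List (Gate D L r),
    gates.Pairwise (fun g g' => Disjoint g.supp g'.supp) →
    ∀ (A : Op (Site D L)) (M : Finset (Site D L)), SupportedOn A M →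
    SupportedOn (((gates.map Gate.op).prod : UOp (Site D L)) * A *
      star ((gates.map Gate.op).prod : UOp (Site D L)) : Op (Site D L))
      (Finset.univ.filter fun a => a ∈ M ∨ ∃ g ∈ gates, a ∈ g.supp ∧ ∃ b ∈ g.supp, b ∈ M)
  | [], _, A, M, hA => by simpa using hA
  | g :: gs, hg, A, M, hA => by
    rw [List.pairwise_cons] at hg
    have ih := spreadsOneWay_gates gs hg.2 A M hA
    rw [List.map_cons, List.prod_cons]
    set P : UOp (Site D L) := (gs.map Gate.op).prod
    set B : Op (Site D L) := (P : Op (Site D L)) * A * star (P : Op (Site D L))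
    have hB : ((g.op * P : UOp (Site D L)) : Op (Site D L)) * A *
        star ((g.op * P : UOp (Site D L)) : Op (Site D L)) =
        (g.op : Op (Site D L)) * B * star (g.op : Op (Site D L)) := by
      change (g.op : Op (Site D L)) * P * A * star ((g.op : Op (Site D L)) * P) = _
      rw [star_mul]
      simp only [B, mul_assoc]
    change SupportedOn (((g.op * P : UOp (Site D L)) : Op (Site D L)) * A *
        star ((g.op * P : UOp (Site D L)) : Op (Site D L))) _
    rw [hB]
    by_cases hd : Disjoint g.supp M
    · have hcomm := g.supported.mul_comm_of_disjoint ih (by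
        rw [Finset.disjoint_left]
        intro a ha ha'
        rcases (Finset.mem_filter.1 ha').2 with h | ⟨g', hg', hag', -⟩
        · exact Finset.disjoint_left.1 hd ha h
        · exact Finset.disjoint_left.1 (hg.1 g' hg') ha hag')
      change (g.op : Op (Site D L)) * B = B * _ at hcomm
      rw [hcomm, mul_assoc, coe_mul_star, mul_one]
      refine SupportedOn.mono ih fun a ha => ?_
      rw [Finset.mem_filter] at ha ⊢
      refine ⟨ha.1, ha.2.imp id ?_⟩
      rintro ⟨g', hg', h⟩
      exact ⟨g', List.mem_cons_of_mem _ hg', h⟩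
    · obtain ⟨b, hb, hbM⟩ := Finset.not_disjoint_iff.1 hd
      have hgs : SupportedOn (g.op : Op (Site D L)) (Finset.univ.filter fun a =>
          a ∈ M ∨ ∃ g' ∈ g :: gs, a ∈ g'.supp ∧ ∃ b ∈ g'.supp, b ∈ M) :=
        g.supported.mono fun a ha => Finset.mem_filter.2
          ⟨Finset.mem_univ _, Or.inr ⟨g, List.mem_cons_self, ha, b, hb, hbM⟩⟩
      refine (hgs.mul (SupportedOn.mono ih fun a ha => ?_)).mul hgs.star
      rw [Finset.mem_filter] at ha ⊢
      refine ⟨ha.1, ha.2.imp id ?_⟩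
      rintro ⟨g', hg', h⟩
      exact ⟨g', List.mem_cons_of_mem _ hg', h⟩

theorem spreadsOneWay_layer (l : Layer D L r) : SpreadsOneWay l.op r := by
  intro A M hA
  refine SupportedOn.mono (spreadsOneWay_gates l.gates l.disjoint A M hA) fun a ha => ?_
  rcases (Finset.mem_filter.1 ha).2 with h | ⟨g, -, hag, b, hbg, hbM⟩
  · exact subset_thicken M r h
  · exact mem_thicken.2 ⟨b, hbM, g.diam a hag b hbg⟩

/-- The inverse gate. -/
def Gate.adj (g : Gate D L r) : Gate D L r :=
  ⟨g.supp, star g.op, g.supported.star, g.diam⟩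

/-- The inverse layer. -/
def Layer.adj (l : Layer D L r) : Layer D L r :=
  ⟨(l.gates.map Gate.adj).reverse, by
    rw [List.pairwise_reverse, List.pairwise_map]
    exact l.disjoint.imp fun h => h.symm⟩

theorem Layer.op_adj (l : Layer D L r) : l.adj.op = star l.op := by
  have : ∀ gs : List (Gate D L r),
      (((gs.map Gate.adj).reverse).map Gate.op).prod = star (gs.map Gate.op).prod := by
    intro gs
    induction gs with
    | nil => simp
    | cons g gs ih =>
      rw [List.map_cons, List.reverse_cons, List.map_append, List.prod_append, ih,
        List.map_cons (l := gs), List.prod_cons, star_mul]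
      simp [Gate.adj]
  exact this l.gates

variable {h : ℕ}

theorem ImplementableBy.star {U : UOp (Site D L)} (hU : ImplementableBy D L r h U) :
    ImplementableBy D L r h (star U) := by
  obtain ⟨c, rfl, rfl⟩ := hU
  refine ⟨(c.map Layer.adj).reverse, by simp, ?_⟩
  induction c with
  | nil => simp
  | cons l c ih =>
    rw [List.map_cons, List.prod_cons, star_mul, ih, List.map_cons, List.reverse_cons,
      List.map_append, List.prod_append]
    simp [Layer.op_adj]

theorem ImplementableBy.mul {h' : ℕ} {U V : UOp (Site D L)} (hU : ImplementableBy D L r h U)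
    (hV : ImplementableBy D L r h' V) : ImplementableBy D L r (h + h') (U * V) := by
  obtain ⟨c, rfl, rfl⟩ := hU
  obtain ⟨c', rfl, rfl⟩ := hV
  exact ⟨c ++ c', by simp, by simp⟩

theorem implementableBy_one (h : ℕ) : ImplementableBy D L r h 1 :=
  ⟨List.replicate h ⟨[], List.Pairwise.nil⟩, by simp, by simp [Layer.op]⟩

theorem ImplementableBy.spreadsOneWay {U : UOp (Site D L)} (hU : ImplementableBy D L r h U) :
    SpreadsOneWay U (h * r) := by
  obtain ⟨c, rfl, rfl⟩ := hU
  induction c with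
  | nil =>
    intro A M hA
    simpa using hA.mono (subset_thicken M 0)
  | cons l c ih =>
    rw [List.map_cons, List.prod_cons, List.length_cons, add_mul, one_mul, add_comm]
    exact (spreadsOneWay_layer l).mul ih

theorem ImplementableBy.spreads {U : UOp (Site D L)} (hU : ImplementableBy D L r h U) :
    Spreads U (h * r) :=
  ⟨hU.spreadsOneWay, hU.star.spreadsOneWay⟩

end Circuits

/-! ### Nested commutators with cleaned logical Pauli operators -/

section Commutators

variable {D L k : ℕ} {C : StabilizerCode (Site D L)}
  {J : Matrix (Site D L → Fin 2) (Fin k → Fin 2) ℂ}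

/-- Take `W = V * P * star V * star P` with `P` a lift of `σ` cleaned off `Λ`. Grouped as `V * (P *
star V * star P)` it stays in `N`, since Paulis do not spread supports. Grouped as `(V * P * star V)
* star P` it stays near the complement of `Λ`. -/
theorem exists_commutator (hJ : C.IsEncoding J) (hC : C.codespace ≠ ⊥) {Λ N : Finset (Site D L)}
    (hΛ : C.Correctable Λ) {V : UOp (Site D L)} (hV : C.IsLogical V) {ρ : ℕ} (hρ : Spreads V ρ)
    (hN : SupportedOn (V : Op (Site D L)) N) {σ : Op (Fin k)} (hσ : IsPauli σ) :
    ∃ W : UOp (Site D L), C.IsLogical W ∧ Spreads W (2 * ρ) ∧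
      SupportedOn (W : Op (Site D L)) (N ∩ thicken Λᶜ ρ) ∧
      encoded J (W : Op (Site D L)) =
        encoded J (V : Op (Site D L)) * σ * star (encoded J (V : Op (Site D L))) * star σ := by
  obtain ⟨P, hP, hL, hPM, e⟩ := hJ.exists_cleaned_pauli hC hΛ hσ
  refine ⟨V * (P * star V * star P), ?_, ?_, ?_, ?_⟩
  · exact isLogical_mul hV (isLogical_mul (isLogical_mul hL (isLogical_star hV))
      (isLogical_star hL))
  · have hs := spreads_of_isPauli hP
    have := hρ.mul ((hs.mul hρ.star).mul hs.star)
    rwa [zero_add, add_zero, ← two_mul] at this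
  · refine SupportedOn.inter ?_ ?_
    · change SupportedOn ((V : Op (Site D L)) *
        ((P : Op (Site D L)) * star (V : Op (Site D L)) * star (P : Op (Site D L)))) N
      refine hN.mul (((spreads_of_isPauli hP).1 _ _ hN.star).mono fun a ha => ?_)
      obtain ⟨b, hb, h⟩ := mem_thicken.1 ha
      have hab : a = b := by
        funext i
        have := h i
        rw [Nat.cast_zero, abs_nonpos_iff, sub_eq_zero, Nat.cast_inj] at this
        exact Fin.ext this
      rwa [hab]
    · change SupportedOn ((V : Op (Site D L)) *
        ((P : Op (Site D L)) * star (V : Op (Site D L)) * star (P : Op (Site D L)))) _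
      rw [← mul_assoc, ← mul_assoc]
      exact (hρ.1 _ _ hPM).mul (hPM.star.mono (subset_thicken _ _))
  · change encoded J ((V : Op (Site D L)) *
      ((P * star V * star P : UOp (Site D L)) : Op (Site D L))) = _
    rw [hJ.encoded_mul _ (isLogical_mul (isLogical_mul hL (isLogical_star hV))
      (isLogical_star hL))]
    change _ * encoded J (((P * star V : UOp (Site D L)) : Op (Site D L)) *
      ((star P : UOp (Site D L)) : Op (Site D L))) = _
    rw [hJ.encoded_mul _ (isLogical_star hL)]
    change _ * (encoded J ((P : Op (Site D L)) * ((star V : UOp (Site D L)) : Op (Site D L))) *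
      encoded J (star (P : Op (Site D L)))) = _
    rw [hJ.encoded_mul _ (isLogical_star hV)]
    change _ * (_ * encoded J (star (V : Op (Site D L))) * _) = _
    rw [encoded_star, encoded_star, e]
    simp only [mul_assoc]

/-- Here `j` counts the commutators already taken, and `m + 1` those still to come. Each commutator
doubles the spread, so `ρ * 2 ^ m ≤ R` keeps every later thickening within `R`. At `m = 0` one more
commutator is confined to `Λ D` and is a scalar, so the encoded gate commutes with all Paulis up to
scalars and is a Pauli. -/
theorem encoded_mem_hierarchy (hJ : C.IsEncoding J) (hC : C.codespace ≠ ⊥)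
    (Λ : ℕ → Finset (Site D L)) (hΛ : ∀ j, C.Correctable (Λ j)) (R : ℕ)
    (hcover : ∀ x, (∀ j < D, x ∈ thicken (Λ j)ᶜ R) → x ∈ Λ D) :
    ∀ (m j : ℕ), j + (m + 1) = D → ∀ (V : UOp (Site D L)) (hV : C.IsLogical V) (ρ : ℕ),
      Spreads V ρ → ρ * 2 ^ m ≤ R → ∀ N : Finset (Site D L), SupportedOn (V : Op (Site D L)) N →
      (∀ x ∈ N, ∀ i < j, x ∈ thicken (Λ i)ᶜ R) → encodedU hJ V hV ∈ hierarchy k (m + 1) := by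
  intro m
  induction m with
  | zero =>
    intro j hj V hV ρ hρ hR N hN hNΛ
    refine isPauli_of_conj fun v => ?_
    obtain ⟨W, hW, -, hWN, e⟩ := exists_commutator hJ hC (hΛ j) hV hρ hN (isPauli_pauliOp v)
    have hWD : SupportedOn (W : Op (Site D L)) (Λ D) := hWN.mono fun x hx => by
      rw [Finset.mem_inter] at hx
      refine hcover x fun i hi => ?_
      rcases (show i < j ∨ i = j by omega) with h | rfl
      · exact hNΛ x hx.1 i h
      · exact thicken_mono _ (by simpa using hR) hx.2
    obtain ⟨c, hc⟩ := hJ.encoded_eq_smul_one hC (hΛ D) hW hWD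
    refine ⟨c, ?_⟩
    have hu : star (encoded J (V : Op (Site D L))) * encoded J (V : Op (Site D L)) = 1 :=
      star_mul_coe (encodedU hJ V hV)
    have hp : star (pauliOp v) * pauliOp v = 1 := star_mul_coe (pauliU v)
    change encoded J (V : Op (Site D L)) * pauliOp v =
      c • (pauliOp v * encoded J (V : Op (Site D L)))
    rw [hc] at e
    calc encoded J (V : Op (Site D L)) * pauliOp v
        = (encoded J (V : Op (Site D L)) * pauliOp v * star (encoded J (V : Op (Site D L))) *
            star (pauliOp v)) * (pauliOp v * encoded J (V : Op (Site D L))) := by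
          rw [mul_assoc _ (star (pauliOp v)), ← mul_assoc (star (pauliOp v)), hp, one_mul,
            mul_assoc _ (star _), hu, mul_one]
      _ = _ := by rw [← e, smul_mul_assoc, one_mul]
  | succ m ih =>
    intro j hj V hV ρ hρ hR N hN hNΛ P hP
    obtain ⟨W, hW, hWρ, hWN, e⟩ := exists_commutator hJ hC (hΛ j) hV hρ hN hP
    have hmem := ih (j + 1) (by omega) W hW (2 * ρ) hWρ (by rw [pow_succ] at hR; linarith) _ hWN
      (fun x hx i hi => by
        rw [Finset.mem_inter] at hx
        rcases (show i < j ∨ i = j by omega) with h | rfl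
        · exact hNΛ x hx.1 i h
        · refine thicken_mono _ (le_trans ?_ hR) hx.2
          exact Nat.le_mul_of_pos_right _ (by positivity))
    have := hierarchy_mul_pauli (m + 1) hmem hP
    convert this using 1
    apply Subtype.ext
    change encoded J (V : Op (Site D L)) * (P : Op (Fin k)) *
      star (encoded J (V : Op (Site D L))) = encoded J (W : Op (Site D L)) * (P : Op (Fin k))
    rw [e, mul_assoc _ (star (P : Op (Fin k))), star_mul_coe, mul_one]

end Commutators

/-! ### Covering the lattice by correctable sets -/

section Geometry

/-- The sites none of whose coordinates lies in the walls of thickness `w` of the grid of period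
`(D + 1) * G` shifted by `j * G`. -/
def awayFromWalls (D L w G j : ℕ) : Finset (Site D L) :=
  Finset.univ.filter fun x => ∀ i, w ≤ ((x i : ℕ) + j * G) % ((D + 1) * G)

/-- The cell of a site in the grid of period `(D + 1) * G` shifted by `j * G`. -/
def cellOf (D L G j : ℕ) (x : Site D L) : Fin D → ℕ :=
  fun i => ((x i : ℕ) + j * G) / ((D + 1) * G)

/-- Between points in different cells that both avoid the walls lies a full wall, so they are more
than `w` apart. -/
theorem div_eq_of_close {ℓ w a b : ℕ} (ha : w ≤ a % ℓ) (hb : w ≤ b % ℓ) (hℓ : 0 < ℓ)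
    (h : |(a : ℤ) - (b : ℤ)| ≤ (w : ℤ)) : a / ℓ = b / ℓ := by
  rw [abs_le] at h
  have key : ∀ a b : ℕ, w ≤ b % ℓ → b ≤ a + w → b / ℓ ≤ a / ℓ := by
    intro a b hb hab
    by_contra! hlt
    have h1 := Nat.div_add_mod a ℓ
    have h2 := Nat.div_add_mod b ℓ
    have h3 := Nat.mod_lt a hℓ
    have h4 : ℓ * (a / ℓ + 1) ≤ ℓ * (b / ℓ) := Nat.mul_le_mul_left _ hlt
    rw [mul_add, mul_one] at h4
    omega
  exact le_antisymm (key b a ha (by omega)) (key a b hb (by omega))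

theorem card_cell_le {D L w G j : ℕ} (hG : 0 < G) (q : Fin D → ℕ) :
    ((awayFromWalls D L w G j).filter fun x => cellOf D L G j x = q).card ≤
      ((D + 1) * G) ^ D := by
  have hℓ : 0 < (D + 1) * G := by positivity
  have hcard : (Finset.univ : Finset (Fin D → Fin ((D + 1) * G))).card = ((D + 1) * G) ^ D := by
    simp
  rw [← hcard]
  refine Finset.card_le_card_of_injOn
    (fun x i => ⟨((x i : ℕ) + j * G) % ((D + 1) * G), Nat.mod_lt _ hℓ⟩) (by simp) ?_
  intro x hx y hy hxy
  have hx' := (Finset.mem_filter.1 hx).2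
  have hy' := (Finset.mem_filter.1 hy).2
  funext i
  have h1 := congrFun (hx'.trans hy'.symm) i
  have h2 := congrArg Fin.val (congrFun hxy i)
  simp only [cellOf] at h1 h2
  have h3 := Nat.div_add_mod ((x i : ℕ) + j * G) ((D + 1) * G)
  have h4 := Nat.div_add_mod ((y i : ℕ) + j * G) ((D + 1) * G)
  rw [h1, h2, h4] at h3
  exact Fin.ext (Nat.add_right_cancel h3.symm)

/-- Walls as thick as the generators' diameter `ξ` keep each generator from touching two cells. A
cell has at most `((D + 1) * G) ^ D` sites, fewer than the distance. -/
theorem correctable_awayFromWalls {D L ξ G : ℕ} {C : StabilizerCode (Site D L)} (hG : 0 < G)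
    (hgen : Subgroup.closure {S : UOp (Site D L) | S ∈ C.stab ∧
      ∃ M : Finset (Site D L), DiamLE M ξ ∧ SupportedOn (S : Op (Site D L)) M} = C.stab)
    (hd : C.HasDistance (((D + 1) * G) ^ D + 1)) (j : ℕ) :
    C.Correctable (awayFromWalls D L ξ G j) := by
  refine correctable_of_pieces (cellOf D L G j) hgen ?_ fun q =>
    correctable_of_card_lt hd (Nat.lt_succ_of_le (card_cell_le hG q))
  rintro S ⟨-, N, hN, hSN⟩
  refine ⟨N, hSN, fun a ha b hb haN hbN => funext fun i => ?_⟩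
  refine div_eq_of_close ((Finset.mem_filter.1 ha).2 i) ((Finset.mem_filter.1 hb).2 i)
    (by positivity) ?_
  have := hN a haN b hbN i
  push_cast
  rwa [add_sub_add_right_eq_sub]

/-- In a fixed coordinate, walls of distinct shifts begin at positions differing by a nonzero
multiple of `G`. Since `w + 2 * R < G`, no point is within `R` of two of them. -/
theorem shift_eq_of_mod_lt {D G w R j j' x y y' : ℕ} (hG : w + 2 * R < G) (hj : j ≤ D)
    (hj' : j' ≤ D) (hy : |(x : ℤ) - y| ≤ R) (hy' : |(x : ℤ) - y'| ≤ R)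
    (h : (y + j * G) % ((D + 1) * G) < w) (h' : (y' + j' * G) % ((D + 1) * G) < w) : j = j' := by
  have h1 := Nat.div_add_mod (y + j * G) ((D + 1) * G)
  have h2 := Nat.div_add_mod (y' + j' * G) ((D + 1) * G)
  set q := (y + j * G) / ((D + 1) * G)
  set q' := (y' + j' * G) / ((D + 1) * G)
  set e := (y + j * G) % ((D + 1) * G)
  set e' := (y' + j' * G) % ((D + 1) * G)
  zify at h1 h2
  rw [abs_le] at hy hy'
  -- This is a multiple of `G` of absolute value below `w + 2 * R`. What remains is a congruence of
  -- `j` and `j'` modulo `D + 1`, which forces equality since both are at most `D`.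
  have hz : (e - e' : ℤ) - (y - y') = 0 := by
    refine Int.eq_zero_of_abs_lt_dvd (m := (G : ℤ))
      ⟨(j - j' : ℤ) - (q - q') * (D + 1), by linear_combination h1 - h2⟩ ?_
    rw [abs_lt]
    constructor <;> omega
  have hmul : (G : ℤ) * ((j - j' : ℤ) - (q - q') * (D + 1)) = 0 := by
    linear_combination hz - h1 + h2
  have hG0 : (G : ℤ) ≠ 0 := by omega
  have hjj : (j - j' : ℤ) = (q - q') * (D + 1) :=
    sub_eq_zero.1 ((mul_eq_zero.1 hmul).resolve_left hG0)
  have : (j - j' : ℤ) = 0 := by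
    refine Int.eq_zero_of_abs_lt_dvd (m := (D + 1 : ℤ)) ⟨q - q', by rw [hjj, mul_comm]⟩ ?_
    rw [abs_lt]
    constructor <;> omega
  omega

theorem mem_awayFromWalls_of_thicken {D L w G R : ℕ} (hG : w + 2 * R < G) (x : Site D L)
    (hx : ∀ j < D, x ∈ thicken (awayFromWalls D L w G j)ᶜ R) : x ∈ awayFromWalls D L w G D := by
  by_contra hxD
  have key : ∀ j : Fin (D + 1), ∃ i : Fin D, ∃ y : ℕ, |((x i : ℕ) : ℤ) - y| ≤ R ∧
      (y + j * G) % ((D + 1) * G) < w := by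
    intro j
    have hj : x ∈ thicken (awayFromWalls D L w G j)ᶜ R := by
      rcases (show (j : ℕ) < D ∨ (j : ℕ) = D by omega) with h | h
      · exact hx j h
      · rw [h]
        exact subset_thicken _ _ (Finset.mem_compl.2 hxD)
    obtain ⟨b, hb, hxb⟩ := mem_thicken.1 hj
    rw [Finset.mem_compl, awayFromWalls, Finset.mem_filter] at hb
    push Not at hb
    obtain ⟨i, hi⟩ := hb (Finset.mem_univ _)
    exact ⟨i, b i, hxb i, hi⟩
  choose i y hy hm using key
  -- Each of the `D + 1` shifts has a nearby wall in one of `D` coordinates, so two shifts share a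
  -- coordinate.
  obtain ⟨j, j', hne, hij⟩ := Fintype.exists_ne_map_eq_of_card_lt i (by simp)
  refine hne (Fin.ext (shift_eq_of_mod_lt hG (Nat.lt_succ_iff.1 j.2) (Nat.lt_succ_iff.1 j'.2)
    (hy j) ?_ (hm j) (hm j')))
  rw [hij]
  exact hy j'

end Geometry

/-! ### Protected gates -/

theorem protectedGates_subset_hierarchy {D k : ℕ} (hD : 1 ≤ D) {Ls : Set ℕ}
    {C : (L : ℕ) → StabilizerCode (Site D L)} (hC : IsTopologicalFamily D k Ls C) (r h : ℕ) :
    ∃ L₀ : ℕ, ∀ L ∈ Ls, L₀ ≤ L → ∀ J : Matrix (Site D L → Fin 2) (Fin k → Fin 2) ℂ,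
      (C L).IsEncoding J → protectedGates (C L) J r h ⊆ hierarchy k D := by
  obtain ⟨ξ, hξ⟩ := hC.localGenerators
  obtain ⟨m, rfl⟩ : ∃ m, D = m + 1 := ⟨D - 1, by omega⟩
  -- The circuit spreads by `h * r`, and this doubles `m = D - 1` times before the last commutator
  -- is formed. `G` is the least spacing with `ξ + 2 * R < G`.
  let R := h * r * 2 ^ m
  let G := ξ + 2 * R + 1
  obtain ⟨L₀, hL₀⟩ := hC.distance (((m + 1 + 1) * G) ^ (m + 1) + 1)
  refine ⟨L₀, fun L hL hLL J hJ g hg => ?_⟩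
  obtain ⟨U, hU, hUL, e⟩ := hg
  have hne := codespace_ne_bot (hC.logicalQubits L hL)
  have : g = encodedU hJ U hUL := Subtype.ext e
  rw [this]
  exact encoded_mem_hierarchy hJ hne (awayFromWalls (m + 1) L ξ G)
    (correctable_awayFromWalls (by positivity) (hξ L hL) (hL₀ L hL hLL)) R
    (mem_awayFromWalls_of_thicken (Nat.lt_succ_self _)) m 0 (by omega) U hUL (h * r) hU.spreads
    le_rfl Finset.univ (supportedOn_univ _) (by simp)

/-! ### From gates of bounded depth to the group they generate. -/

section Closure

variable {D L k r : ℕ} {C : StabilizerCode (Site D L)}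
  {J : Matrix (Site D L → Fin 2) (Fin k → Fin 2) ℂ}

theorem one_mem_protectedGates (hJ : C.IsEncoding J) (h : ℕ) : 1 ∈ protectedGates C J r h :=
  ⟨1, implementableBy_one h, isLogical_one, hJ.encoded_one.symm⟩

theorem mul_mem_protectedGates (hJ : C.IsEncoding J) {h h' : ℕ} {g g' : UOp (Fin k)}
    (hg : g ∈ protectedGates C J r h) (hg' : g' ∈ protectedGates C J r h') :
    g * g' ∈ protectedGates C J r (h + h') := by
  obtain ⟨U, hU, hUL, e⟩ := hg
  obtain ⟨U', hU', hUL', e'⟩ := hg'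
  refine ⟨U * U', hU.mul hU', isLogical_mul hUL hUL', ?_⟩
  change (g : Op (Fin k)) * (g' : Op (Fin k)) = encoded J ((U : Op (Site D L)) * U')
  rw [hJ.encoded_mul _ hUL', e, e']

theorem inv_mem_protectedGates {h : ℕ} {g : UOp (Fin k)} (hg : g ∈ protectedGates C J r h) :
    g⁻¹ ∈ protectedGates C J r h := by
  obtain ⟨U, hU, hUL, e⟩ := hg
  refine ⟨star U, hU.star, isLogical_star hUL, ?_⟩
  change star (g : Op (Fin k)) = encoded J (star (U : Op (Site D L)))
  rw [encoded_star, e]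

theorem protectedGates_mono (hJ : C.IsEncoding J) {h h' : ℕ} (hh : h ≤ h') :
    protectedGates C J r h ⊆ protectedGates C J r h' := by
  intro g hg
  have := mul_mem_protectedGates hJ hg (one_mem_protectedGates hJ (r := r) (h' - h))
  rwa [mul_one, Nat.add_sub_cancel' hh] at this

theorem exists_eq_succ_of_monotone {α : Type} {F : Finset α} (A : ℕ → Finset α)
    (hA : Monotone A) (hF : ∀ m, A m ⊆ F) : ∃ m ≤ F.card, A m = A (m + 1) := by
  by_contra! hne
  have key : ∀ m ≤ F.card + 1, m ≤ (A m).card := by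
    intro m
    induction m with
    | zero => simp
    | succ m ih =>
      intro hm
      have h1 := ih (by omega)
      have h2 := Finset.card_lt_card (lt_of_le_of_ne (hA (Nat.le_add_right m 1)) (hne m (by omega)))
      omega
  have h1 := key _ le_rfl
  have h2 := Finset.card_le_card (hF (F.card + 1))
  omega

/-- If the gates of depth `h * (N + 1)` lie in a set with at most `N` elements up to phases, then
the gates of depth `h` generate a group that consists of such gates up to phases. -/
theorem closure_protectedGates_phase (hJ : C.IsEncoding J) {h : ℕ} (F : Finset (UOp (Fin k)))
    (hF : ∀ U ∈ protectedGates C J r (h * (F.card + 1)), ∃ V ∈ F, ∃ γ : ℂ, ‖γ‖ = 1 ∧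
      (U : Op (Fin k)) = γ • (V : Op (Fin k)))
    {g : UOp (Fin k)} (hg : g ∈ Subgroup.closure (protectedGates C J r h)) :
    ∃ U ∈ protectedGates C J r (h * (F.card + 1)), ∃ γ : ℂ, ‖γ‖ = 1 ∧
      (g : Op (Fin k)) = γ • (U : Op (Fin k)) := by
  classical
  -- The phase representatives reached at depth `h * m`. The chain is stationary at some `m ≤
  -- F.card`, and the step compares depths `h * m` and `h * (m + 1)`, whence the `F.card + 1` in the
  -- statement.
  let A : ℕ → Finset (UOp (Fin k)) := fun m => F.filter fun V =>
    ∃ U ∈ protectedGates C J r (h * m), ∃ γ : ℂ, ‖γ‖ = 1 ∧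
      (U : Op (Fin k)) = γ • (V : Op (Fin k))
  have hmono : Monotone A := by
    intro m m' hm V hV
    obtain ⟨hVF, U, hU, h'⟩ := Finset.mem_filter.1 hV
    exact Finset.mem_filter.2
      ⟨hVF, U, protectedGates_mono hJ (Nat.mul_le_mul_left h hm) hU, h'⟩
  obtain ⟨m, hm, hAm⟩ := exists_eq_succ_of_monotone A hmono fun m => Finset.filter_subset _ _
  have hstep : ∀ U ∈ protectedGates C J r (h * (m + 1)), ∃ U' ∈ protectedGates C J r (h * m),
      ∃ γ : ℂ, ‖γ‖ = 1 ∧ (U : Op (Fin k)) = γ • (U' : Op (Fin k)) := by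
    intro U hU
    obtain ⟨V, hV, γ, hγ, e⟩ :=
      hF U (protectedGates_mono hJ (Nat.mul_le_mul_left h (by omega)) hU)
    have hVA : V ∈ A m := by
      rw [hAm]
      exact Finset.mem_filter.2 ⟨hV, U, hU, γ, hγ, e⟩
    obtain ⟨-, U', hU', δ, hδ, e'⟩ := Finset.mem_filter.1 hVA
    have hδ0 : δ ≠ 0 := by rintro rfl; simp at hδ
    exact ⟨U', hU', γ * δ⁻¹, by simp [hγ, hδ], by rw [e, e', smul_smul, inv_mul_cancel_right₀ hδ0]⟩
  have hmul : ∀ g x : UOp (Fin k), g ∈ protectedGates C J r h →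
      (∃ U ∈ protectedGates C J r (h * m), ∃ γ : ℂ, ‖γ‖ = 1 ∧
        (x : Op (Fin k)) = γ • (U : Op (Fin k))) →
      ∃ U ∈ protectedGates C J r (h * m), ∃ γ : ℂ, ‖γ‖ = 1 ∧
        ((g * x : UOp (Fin k)) : Op (Fin k)) = γ • (U : Op (Fin k)) := by
    rintro g x hg ⟨U, hU, γ, hγ, e⟩
    have hgU := mul_mem_protectedGates hJ hg hU
    rw [show h + h * m = h * (m + 1) by ring] at hgU
    obtain ⟨U', hU', δ, hδ, e'⟩ := hstep _ hgU
    refine ⟨U', hU', γ * δ, by simp [hγ, hδ], ?_⟩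
    change (g : Op (Fin k)) * (x : Op (Fin k)) = _
    rw [e, mul_smul_comm, ← smul_smul, ← e']
    rfl
  -- Left multiplication by a generator or its inverse raises the depth by only `h`, and `hstep`
  -- returns it to `h * m` up to phase. A single stationary step therefore controls words of any
  -- length.
  have hall : ∃ U ∈ protectedGates C J r (h * m), ∃ γ : ℂ, ‖γ‖ = 1 ∧
      (g : Op (Fin k)) = γ • (U : Op (Fin k)) := by
    induction hg using Subgroup.closure_induction_left with
    | one => exact ⟨1, one_mem_protectedGates hJ _, 1, by simp, by simp⟩
    | mul_left g hg x _ ih => exact hmul g x hg ih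
    | inv_mul_cancel g hg x _ ih => exact hmul g⁻¹ x (inv_mem_protectedGates hg) ih
  obtain ⟨U, hU, h'⟩ := hall
  exact ⟨U, protectedGates_mono hJ (Nat.mul_le_mul_left h (by omega)) hU, h'⟩

end Closure

end TopoCode

theorem corollary1 (D k : ℕ) (hD : 1 ≤ D) (Ls : Set ℕ)
    (C : (L : ℕ) → TopoCode.StabilizerCode (TopoCode.Site D L))
    (hC : TopoCode.IsTopologicalFamily D k Ls C) :
    TopoCode.FiniteUpToPhase (TopoCode.hierarchy k D) ∧
    ∀ r h : ℕ, ∃ L₀ : ℕ, ∀ L ∈ Ls, L₀ ≤ L →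
      ∀ J : Matrix (TopoCode.Site D L → Fin 2) (Fin k → Fin 2) ℂ, (C L).IsEncoding J →
        (Subgroup.closure (TopoCode.protectedGates (C L) J r h) : Set (TopoCode.UOp (Fin k))) ⊆
          TopoCode.hierarchy k D ∧
        (1 ≤ k → ¬ TopoCode.IsUniversal (TopoCode.protectedGates (C L) J r h)) := by
  have hfin := TopoCode.finiteUpToPhase_hierarchy (k := k) D
  refine ⟨hfin, fun r h => ?_⟩
  obtain ⟨F, hF, hFD⟩ := id hfin
  -- The threshold is taken for the larger depth at which the pigeonhole operates. `F` depends only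
  -- on `k` and `D`, so `L₀` is independent of `L` and `J`.
  obtain ⟨L₀, hL₀⟩ := TopoCode.protectedGates_subset_hierarchy hD hC r
    (h * (hF.toFinset.card + 1))
  refine ⟨L₀, fun L hL hLL J hJ => ?_⟩
  have hsub : (Subgroup.closure (TopoCode.protectedGates (C L) J r h) :
      Set (TopoCode.UOp (Fin k))) ⊆ TopoCode.hierarchy k D := by
    intro g hg
    obtain ⟨U, hU, γ, hγ, e⟩ := TopoCode.closure_protectedGates_phase hJ hF.toFinset
      (fun U hU => by simpa using hFD U (hL₀ L hL hLL J hJ hU)) hg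
    exact TopoCode.hierarchy_phase_smul D hγ e (hL₀ L hL hLL J hJ hU)
  exact ⟨hsub, fun hk => TopoCode.not_isUniversal_of_finiteUpToPhase hk hfin hsub⟩
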